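/- Let $n_+,n_-\ge 1$ and $n=n_++n_-$. Let $\lambda_1,\dots,\lambda_{n_+}:[0,\infty)\to(0,\infty)$ and $\theta_1,\dots,\theta_{n_-}:[0,\infty)\to(-\infty,0)$ be continuous and bounded. Put $\Lambda=\operatorname{diag}(\lambda_k)$, $\Theta=\operatorname{diag}(\theta_j)$, $\Delta=\operatorname{diag}(\Lambda,\Theta)$, and let $X=L^2_{|\Delta|}(0,\infty)$ be the Hilbert space of measurable $x=(x_+,x_-):[0,\infty)\to\mathbb C^{n_+}\times\mathbb C^{n_-}$ with $\|x\|^2=\int_0^\infty x(\xi)^*|\Delta(\xi)|x(\xi)\,d\xi<\infty$. On $$D=D(\mathcal A)=D(\mathcal B)=D(\mathcal C)=\{x\in X:\ \Delta x\in AC_{\rm loc}[0,\infty),\ (\Delta x)'\in X\}$$ define $\mathcal Ax=(\Delta x)'$, $\mathcal Bx=(\Theta x_-)(0)\in\mathbb C^{n_-}$ and $\mathcal Cx=(\Lambda x_+)(0)\in\mathbb C^{n_+}$. Consider the system $\dot x=\mathcal Ax$, $u=\mathcal Bx$, $y=\mathcal Cx$, and let $A$ be the restriction of $\mathcal A$ to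 $D\cap\ker\mathcal B$. A classical solution on $[0,\tau]$ is a function $x\in C^1([0,\tau],X)$ with values in $D$ that satisfies these equations for all $t\in[0,\tau]$. Then: 1. The system is a boundary control system, i.e. $A$ generates a $C_0$-semigroup on $X$; there is a bounded linear $B:\mathbb C^{n_-}\to X$ with values in $D$ such that $\mathcal AB$ is bounded and $\mathcal BBu=u$ for all $u$; and $\mathcal C$ is bounded on $D(A)$ with respect to the graph norm of $A$. 2. The system is well-posed: for every $\tau>0$ there is $m_\tau>0$ such that for all $x_0\in D$ and all $u\in C^2([0,\tau],\mathbb C^{n_-})$ with $u(0)=\mathcal Bx_0$ there is a unique classical solution $x$ on $[0,\tau]$ with input $u$ and $x(0)=x_0$, and its output $y=\mathcal Cx$ satisfies $$\|x(\tau)\|^2+\int_0^\tau\|y(t)\|^2\,dt\le m_\tau\Big(\|x_0\|^2+\int_0^\tau\|u(t)\|^2\,dt\Big).$$ 3. Every classical solution satisfies the energy balance $\frac{d}{dt}\|x(t)\|^2=\|u(t)\|^2-\|y(t)\|^2$. 4. The transfer function is zero: every $s\in\mathbb C$ with $\operatorname{Re}s>0$ belongs to the resolvent set $\rho(A)$,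 and for every $B$ as in 1 and every $s\in\rho(A)$, $$G(s)=\mathcal C(s-A)^{-1}(\mathcal AB-sB)+\mathcal CB=0.$$ -/

import Mathlib

open MeasureTheory Set Filter Topology

noncomputable section

/-! ## Semigroups, generators, resolvents of partially defined operators -/

/-- `(T t)_{t ≥ 0}` is a `C₀`-semigroup of bounded operators on `X`
(values of `T` at negative times are irrelevant). -/
structure IsC0Semigroup {X : Type*} [NormedAddCommGroup X] [NormedSpace ℂ X]
    (T : ℝ → X →L[ℂ] X) : Prop where
  map_zero : T 0 = ContinuousLinearMap.id ℂ X
  map_add : ∀ s t : ℝ, 0 ≤ s → 0 ≤ t → T (s + t) = (T s).comp (T t)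
  strongly_continuous : ∀ x : X, Tendsto (fun t : ℝ => T t x) (𝓝[>] 0) (𝓝 x)

/-- `A` is the generator of the `C₀`-semigroup `T`: one has `x ∈ D(A)` and `A x = y` if and only if
the difference quotients `(T t x - x) / t` converge to `y` as `t ↓ 0`. -/
def IsGeneratorOf {X : Type*} [NormedAddCommGroup X] [NormedSpace ℂ X]
    (A : X →ₗ.[ℂ] X) (T : ℝ → X →L[ℂ] X) : Prop :=
  ∀ x y : X, (x, y) ∈ A.graph ↔
    Tendsto (fun t : ℝ => ((t : ℂ)⁻¹) • (T t x - x)) (𝓝[>] 0) (𝓝 y)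

/-- `A` generates a `C₀`-semigroup on `X`. -/
def GeneratesC0Semigroup {X : Type*} [NormedAddCommGroup X] [NormedSpace ℂ X]
    (A : X →ₗ.[ℂ] X) : Prop :=
  ∃ T : ℝ → X →L[ℂ] X, IsC0Semigroup T ∧ IsGeneratorOf A T

/-- `R = (s - A)⁻¹`: `R` is a bounded operator on `X` with values in `D(A)` that is a two-sided
inverse of `s - A : D(A) → X`. -/
def IsResolventAt {X : Type*} [NormedAddCommGroup X] [NormedSpace ℂ X]
    (A : X →ₗ.[ℂ] X) (s : ℂ) (R : X →L[ℂ] X) : Prop :=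
  (∀ y : X, ∃ h : R y ∈ A.domain, s • R y - A ⟨R y, h⟩ = y) ∧
    ∀ x : A.domain, R (s • (x : X) - A x) = x

/-- The resolvent set `ρ(A)`. -/
def unboundedResolventSet {X : Type*} [NormedAddCommGroup X] [NormedSpace ℂ X]
    (A : X →ₗ.[ℂ] X) : Set ℂ :=
  {s | ∃ R : X →L[ℂ] X, IsResolventAt A s R}

/-- The resolvent operator `(s - A)⁻¹` for `s ∈ ρ(A)`. -/
def resolventAt {X : Type*} [NormedAddCommGroup X] [NormedSpace ℂ X]
    (A : X →ₗ.[ℂ] X) (s : ℂ) (hs : s ∈ unboundedResolventSet A) : X →L[ℂ] X :=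
  hs.choose

theorem resolventAt_mem {X : Type*} [NormedAddCommGroup X] [NormedSpace ℂ X]
    (A : X →ₗ.[ℂ] X) (s : ℂ) (hs : s ∈ unboundedResolventSet A) (y : X) :
    resolventAt A s hs y ∈ A.domain :=
  (hs.choose_spec.1 y).choose

/-! ## Abstract boundary control systems -/

/-- The data `ẋ = 𝒜 x`, `u = ℬ x`, `y = 𝒞 x` with state space `X`, input space `U` and output
space `Y`: linear operators `𝒜 : D(𝒜) ⊆ X → X`, `ℬ : D(ℬ) ⊆ X → U`, `𝒞 : D(𝒜) → Y` such that
`D(𝒜) ⊆ D(ℬ)`. -/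
structure BoundarySystem (X U Y : Type*)
    [NormedAddCommGroup X] [InnerProductSpace ℂ X] [CompleteSpace X]
    [NormedAddCommGroup U] [InnerProductSpace ℂ U] [CompleteSpace U]
    [NormedAddCommGroup Y] [InnerProductSpace ℂ Y] [CompleteSpace Y] where
  opA : X →ₗ.[ℂ] X
  opB : X →ₗ.[ℂ] U
  domain_le : opA.domain ≤ opB.domain
  opC : opA.domain →ₗ[ℂ] Y

namespace BoundarySystem

variable {X U Y : Type*}
  [NormedAddCommGroup X] [InnerProductSpace ℂ X] [CompleteSpace X]
  [NormedAddCommGroup U] [InnerProductSpace ℂ U] [CompleteSpace U]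
  [NormedAddCommGroup Y] [InnerProductSpace ℂ Y] [CompleteSpace Y]

/-- The operator `A`: the restriction of `𝒜` to `D(A) = D(𝒜) ∩ ker ℬ`. -/
def restrictedOp (S : BoundarySystem X U Y) : X →ₗ.[ℂ] X :=
  S.opA.domRestrict ((LinearMap.ker S.opB.toFun).map S.opB.domain.subtype)

theorem restrictedOp_domain_le (S : BoundarySystem X U Y) : S.restrictedOp.domain ≤ S.opA.domain :=
  inf_le_right

/-- A bounded operator `B : U → X` with values in `D(𝒜)` such that `𝒜 B` is bounded and
`ℬ B u = u` for all `u`. -/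
structure Lifting (S : BoundarySystem X U Y) where
  op : U →L[ℂ] X
  mem : ∀ u : U, op u ∈ S.opA.domain
  bounded : ∃ K : ℝ, ∀ u : U, ‖S.opA ⟨op u, mem u⟩‖ ≤ K * ‖u‖
  right_inv : ∀ u : U, S.opB ⟨op u, S.domain_le (mem u)⟩ = u

/-- `Σ` is a boundary control system: `A` generates a `C₀`-semigroup on `X`, there is a lifting
`B`, and `𝒞` is bounded on `D(A)` with respect to the graph norm of `A`. -/
structure IsBoundaryControlSystem (S : BoundarySystem X U Y) : Prop where
  generates : GeneratesC0Semigroup S.restrictedOp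
  lifting : Nonempty S.Lifting
  output_bounded : ∃ K : ℝ, ∀ x : S.restrictedOp.domain,
    ‖S.opC ⟨x, S.restrictedOp_domain_le x.2⟩‖ ≤ K * (‖(x : X)‖ + ‖S.restrictedOp x‖)

/-- `x` is a classical solution on `[0, τ]` of the system with input `u`, initial value `x₀` and
output `y`: `x ∈ C¹([0, τ], X)`, `x(0) = x₀`, and for all `t ∈ [0, τ]` one has `x(t) ∈ D(𝒜)`,
`ẋ(t) = 𝒜 x(t)`, `ℬ x(t) = u(t)` and `𝒞 x(t) = y(t)`. -/
structure IsClassicalSolution (S : BoundarySystem X U Y) (τ : ℝ) (x₀ : X) (u : ℝ → U)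
    (x : ℝ → X) (y : ℝ → Y) : Prop where
  initial : x 0 = x₀
  contDiffOn : ContDiffOn ℝ 1 x (Icc 0 τ)
  equations : ∀ t ∈ Icc 0 τ, ∃ h : x t ∈ S.opA.domain,
    HasDerivWithinAt x (S.opA ⟨x t, h⟩) (Icc 0 τ) t ∧
    S.opB ⟨x t, S.domain_le h⟩ = u t ∧
    S.opC ⟨x t, h⟩ = y t

/-- Well-posedness: for every `τ > 0` there is `m > 0` such that for all `x₀ ∈ D(𝒜)` and all
`u ∈ C²([0, τ], U)` with `u(0) = ℬ x₀` there is a unique classical solution on `[0, τ]`, and it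
satisfies `‖x(τ)‖² + ∫₀^τ ‖y‖² ≤ m (‖x₀‖² + ∫₀^τ ‖u‖²)` (with `‖y‖²` integrable, so that the
integral is not a default value). -/
def WellPosed (S : BoundarySystem X U Y) : Prop :=
  ∀ τ : ℝ, 0 < τ → ∃ m : ℝ, 0 < m ∧
    ∀ (x₀ : S.opA.domain) (u : ℝ → U), ContDiffOn ℝ 2 u (Icc 0 τ) →
      u 0 = S.opB ⟨x₀, S.domain_le x₀.2⟩ →
      ∃ (x : ℝ → X) (y : ℝ → Y), S.IsClassicalSolution τ x₀ u x y ∧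
        (∀ (x' : ℝ → X) (y' : ℝ → Y), S.IsClassicalSolution τ x₀ u x' y' →
          EqOn x' x (Icc 0 τ)) ∧
        IntervalIntegrable (fun t => ‖y t‖ ^ 2) volume 0 τ ∧
        ‖x τ‖ ^ 2 + ∫ t in (0 : ℝ)..τ, ‖y t‖ ^ 2 ≤
          m * (‖(x₀ : X)‖ ^ 2 + ∫ t in (0 : ℝ)..τ, ‖u t‖ ^ 2)

/-- The energy balance `d/dt ‖x(t)‖² = ‖u(t)‖² - ‖y(t)‖²` along every classical solution. -/
def EnergyBalance (S : BoundarySystem X U Y) : Prop :=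
  ∀ (τ : ℝ) (x₀ : X) (u : ℝ → U) (x : ℝ → X) (y : ℝ → Y), 0 < τ →
    S.IsClassicalSolution τ x₀ u x y → ∀ t ∈ Icc 0 τ,
      HasDerivWithinAt (fun r => ‖x r‖ ^ 2) (‖u t‖ ^ 2 - ‖y t‖ ^ 2) (Icc 0 τ) t

/-- The value `G(s) = 𝒞 (s - A)⁻¹ (𝒜 B - s B) + 𝒞 B` of the transfer function at `s ∈ ρ(A)`,
formed with the lifting `B`. -/
def transferFunction (S : BoundarySystem X U Y) (B : S.Lifting) (s : ℂ)
    (hs : s ∈ unboundedResolventSet S.restrictedOp) (u : U) : Y :=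
  S.opC ⟨resolventAt S.restrictedOp s hs (S.opA ⟨B.op u, B.mem u⟩ - s • B.op u),
      S.restrictedOp_domain_le (resolventAt_mem S.restrictedOp s hs _)⟩ +
    S.opC ⟨B.op u, B.mem u⟩

end BoundarySystem

/-! ## The diagonal system on the half-line -/

/-- The diagonal entries of `Δ = diag(Λ, Θ)` on `[0, ∞)`: continuous `λ₁, …, λ_p > 0` and
continuous `θ₁, …, θ_m < 0` (values at negative arguments are irrelevant). -/
structure SignedDiagonal (p m : ℕ) where
  lam : Fin p → ℝ → ℝ
  theta : Fin m → ℝ → ℝ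
  lam_continuousOn : ∀ k, ContinuousOn (lam k) (Ici 0)
  theta_continuousOn : ∀ j, ContinuousOn (theta j) (Ici 0)
  lam_pos : ∀ k, ∀ ξ : ℝ, 0 ≤ ξ → 0 < lam k ξ
  theta_neg : ∀ j, ∀ ξ : ℝ, 0 ≤ ξ → theta j ξ < 0

/-- The measure `|w(ξ)| dξ` on `[0, ∞)`. -/
def weightedMeasure (w : ℝ → ℝ) : Measure ℝ :=
  (volume.restrict (Ici 0)).withDensity (fun ξ => ENNReal.ofReal |w ξ|)

/-- `f` is locally absolutely continuous on `[0, ∞)`. -/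
def LocallyAbsolutelyContinuous (f : ℝ → ℂ) : Prop :=
  ∀ a b : ℝ, 0 ≤ a → a ≤ b → AbsolutelyContinuousOnInterval f a b

theorem LocallyAbsolutelyContinuous.continuousOn {f : ℝ → ℂ}
    (hf : LocallyAbsolutelyContinuous f) : ContinuousOn f (Ici 0) := by
  intro x hx
  have hx : (0 : ℝ) ≤ x := hx
  have h := (hf 0 (x + 1) le_rfl (by linarith)).continuousOn
  rw [uIcc_of_le (by linarith : (0 : ℝ) ≤ x + 1)] at h
  refine (h x ⟨hx, by linarith⟩).mono_of_mem_nhdsWithin ?_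
  rw [← Ici_inter_Iic]
  exact inter_mem_nhdsWithin _ (Iic_mem_nhds (by linarith))

theorem ae_weightedMeasure {w : ℝ → ℝ} (hw : ContinuousOn w (Ici 0))
    (h0 : ∀ ξ : ℝ, 0 ≤ ξ → w ξ ≠ 0) :
    ae (weightedMeasure w) = ae (volume.restrict (Ici (0 : ℝ))) := by
  apply le_antisymm
  · exact (withDensity_absolutelyContinuous _ _).ae_le
  · refine (withDensity_absolutelyContinuous' ?_ ?_).ae_le
    · exact (hw.abs.aemeasurable measurableSet_Ici).ennreal_ofReal
    · filter_upwards [ae_restrict_mem measurableSet_Ici] with ξ hξ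
      simpa using h0 ξ hξ

namespace SignedDiagonal

variable {p m : ℕ} (D : SignedDiagonal p m)

/-- The diagonal entries of `Δ`, the `λ`'s first. -/
def entry : Fin p ⊕ Fin m → ℝ → ℝ := Sum.elim D.lam D.theta

theorem entry_continuousOn (i : Fin p ⊕ Fin m) : ContinuousOn (D.entry i) (Ici 0) := by
  rcases i with k | j
  · exact D.lam_continuousOn k
  · exact D.theta_continuousOn j

theorem entry_ne_zero (i : Fin p ⊕ Fin m) (ξ : ℝ) (hξ : 0 ≤ ξ) : D.entry i ξ ≠ 0 := by
  rcases i with k | j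
  · exact (D.lam_pos k ξ hξ).ne'
  · exact (D.theta_neg j ξ hξ).ne

/-- The Hilbert space `L²_{|Δ|}(0, ∞)` of (classes of) measurable `x : [0, ∞) → ℂⁿ` such that
`‖x‖² = ∫ x(ξ)* |Δ(ξ)| x(ξ) dξ = ∑ᵢ ∫ |Δᵢ(ξ)| |xᵢ(ξ)|² dξ` is finite, as the orthogonal sum of the
weighted `L²`-spaces of the coordinates. -/
abbrev State : Type :=
  PiLp 2 (fun i : Fin p ⊕ Fin m => Lp ℂ 2 (weightedMeasure (D.entry i)))

/-- `f` is the locally absolutely continuous representative of `Δ x`, and its almost everywhere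
derivative is `z`, i.e. `z = (Δ x)'`. -/
structure IsRepresentative (x : D.State) (f : Fin p ⊕ Fin m → ℝ → ℂ) (z : D.State) : Prop where
  absCont : ∀ i, LocallyAbsolutelyContinuous (f i)
  eq_mul : ∀ i, ∀ᵐ ξ ∂(volume.restrict (Ici (0 : ℝ))), f i ξ = (D.entry i ξ : ℂ) * x i ξ
  hasDerivAt : ∀ i, ∀ᵐ ξ ∂(volume.restrict (Ici (0 : ℝ))), HasDerivAt (f i) (z i ξ) ξ

variable {D}

theorem ae_of_ae (i : Fin p ⊕ Fin m) {q : ℝ → Prop}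
    (h : ∀ᵐ ξ ∂(weightedMeasure (D.entry i)), q ξ) :
    ∀ᵐ ξ ∂(volume.restrict (Ici (0 : ℝ))), q ξ := by
  rwa [ae_weightedMeasure (D.entry_continuousOn i) (D.entry_ne_zero i)] at h

namespace IsRepresentative

theorem zero : D.IsRepresentative 0 0 0 where
  absCont i a b _ _ := by
    exact (contDiff_const (c := (0 : ℂ))).contDiffOn.absolutelyContinuousOnInterval
  eq_mul i := by
    filter_upwards [ae_of_ae i (Lp.coeFn_zero ℂ 2 (weightedMeasure (D.entry i)))] with ξ h
    simp only [PiLp.zero_apply, h]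
    simp
  hasDerivAt i := by
    filter_upwards [ae_of_ae i (Lp.coeFn_zero ℂ 2 (weightedMeasure (D.entry i)))] with ξ h
    simp only [PiLp.zero_apply, h]
    exact hasDerivAt_const ξ (0 : ℂ)

theorem add {x x' z z' : D.State} {f f' : Fin p ⊕ Fin m → ℝ → ℂ}
    (h : D.IsRepresentative x f z) (h' : D.IsRepresentative x' f' z') :
    D.IsRepresentative (x + x') (f + f') (z + z') where
  absCont i a b ha hb := (h.absCont i a b ha hb).add (h'.absCont i a b ha hb)
  eq_mul i := by
    filter_upwards [h.eq_mul i, h'.eq_mul i, ae_of_ae i (Lp.coeFn_add (x i) (x' i))]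
      with ξ h1 h2 h3
    simp only [PiLp.add_apply, h3, Pi.add_apply, h1, h2]
    ring
  hasDerivAt i := by
    filter_upwards [h.hasDerivAt i, h'.hasDerivAt i, ae_of_ae i (Lp.coeFn_add (z i) (z' i))]
      with ξ h1 h2 h3
    simp only [PiLp.add_apply, h3, Pi.add_apply]
    exact h1.add h2

theorem smul {x z : D.State} {f : Fin p ⊕ Fin m → ℝ → ℂ}
    (c : ℂ) (h : D.IsRepresentative x f z) :
    D.IsRepresentative (c • x) (c • f) (c • z) where
  absCont i a b ha hb := (h.absCont i a b ha hb).const_smul c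
  eq_mul i := by
    filter_upwards [h.eq_mul i, ae_of_ae i (Lp.coeFn_smul c (x i))] with ξ h1 h3
    simp only [PiLp.smul_apply, h3, Pi.smul_apply, h1, smul_eq_mul]
    ring
  hasDerivAt i := by
    filter_upwards [h.hasDerivAt i, ae_of_ae i (Lp.coeFn_smul c (z i))] with ξ h1 h3
    simp only [PiLp.smul_apply, h3, Pi.smul_apply]
    exact h1.const_smul c

/-- The continuous representative of `Δ x` is unique on `[0, ∞)`. -/
theorem eqOn {x z z' : D.State} {f f' : Fin p ⊕ Fin m → ℝ → ℂ}
    (h : D.IsRepresentative x f z) (h' : D.IsRepresentative x f' z') (i : Fin p ⊕ Fin m) :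
    EqOn (f i) (f' i) (Ici 0) := by
  refine Measure.eqOn_of_ae_eq (μ := volume) ?_ (h.absCont i).continuousOn
    (h'.absCont i).continuousOn ?_
  · filter_upwards [h.eq_mul i, h'.eq_mul i] with ξ h1 h2
    rw [h1, h2]
  · simp

/-- The derivative `(Δ x)'` is unique. -/
theorem deriv_eq {x z z' : D.State} {f f' : Fin p ⊕ Fin m → ℝ → ℂ}
    (h : D.IsRepresentative x f z) (h' : D.IsRepresentative x f' z') : z = z' := by
  ext i : 1
  apply Lp.ext
  have key : ∀ᵐ ξ ∂(volume.restrict (Ici (0 : ℝ))), z i ξ = z' i ξ := by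
    have hpos : ∀ᵐ ξ ∂(volume.restrict (Ici (0 : ℝ))), ξ ∈ Ioi (0 : ℝ) := by
      rw [← restrict_Ioi_eq_restrict_Ici]
      exact ae_restrict_mem measurableSet_Ioi
    filter_upwards [h.hasDerivAt i, h'.hasDerivAt i, hpos] with ξ h1 h2 h3
    refine h1.unique (h2.congr_of_eventuallyEq ?_)
    filter_upwards [Ioi_mem_nhds h3] with η hη
    exact h.eqOn h' i (le_of_lt (mem_Ioi.1 hη))
  have hae := ae_weightedMeasure (D.entry_continuousOn i) (D.entry_ne_zero i)
  change ∀ᵐ ξ ∂(weightedMeasure (D.entry i)), z i ξ = z' i ξ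
  rwa [hae]

end IsRepresentative

variable (D)

/-- `{x ∈ L²_{|Δ|} : Δ x ∈ AC_loc[0, ∞) and (Δ x)' ∈ L²_{|Δ|}}`. -/
def domain : Submodule ℂ D.State where
  carrier := {x | ∃ f z, D.IsRepresentative x f z}
  add_mem' := by
    rintro x x' ⟨f, z, h⟩ ⟨f', z', h'⟩
    exact ⟨_, _, h.add h'⟩
  zero_mem' := ⟨_, _, IsRepresentative.zero⟩
  smul_mem' := by
    rintro c x ⟨f, z, h⟩
    exact ⟨_, _, h.smul c⟩

/-- The locally absolutely continuous representative of `Δ x`. -/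
def rep (x : D.domain) : Fin p ⊕ Fin m → ℝ → ℂ := x.2.choose

/-- The element `(Δ x)'` of `L²_{|Δ|}`. -/
def derivative (x : D.domain) : D.State := x.2.choose_spec.choose

theorem isRepresentative (x : D.domain) : D.IsRepresentative x (D.rep x) (D.derivative x) :=
  x.2.choose_spec.choose_spec

theorem rep_add_zero (x x' : D.domain) (i : Fin p ⊕ Fin m) :
    D.rep (x + x') i 0 = D.rep x i 0 + D.rep x' i 0 :=
  (D.isRepresentative (x + x')).eqOn ((D.isRepresentative x).add (D.isRepresentative x')) i
    self_mem_Ici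

theorem rep_smul_zero (c : ℂ) (x : D.domain) (i : Fin p ⊕ Fin m) :
    D.rep (c • x) i 0 = c * D.rep x i 0 :=
  (D.isRepresentative (c • x)).eqOn ((D.isRepresentative x).smul c) i self_mem_Ici

/-- The system `𝒜 x = (Δ x)'`, `ℬ x = (Θ x₋)(0)`, `𝒞 x = (Λ x₊)(0)` with
`D(𝒜) = D(ℬ) = D(𝒞) = {x ∈ L²_{|Δ|} : Δ x ∈ AC_loc[0, ∞) and (Δ x)' ∈ L²_{|Δ|}}`. -/
def system : BoundarySystem D.State (EuclideanSpace ℂ (Fin m)) (EuclideanSpace ℂ (Fin p)) where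
  opA :=
    { domain := D.domain
      toFun :=
        { toFun := D.derivative
          map_add' := fun x x' => (D.isRepresentative (x + x')).deriv_eq
            ((D.isRepresentative x).add (D.isRepresentative x'))
          map_smul' := fun c x => (D.isRepresentative (c • x)).deriv_eq
            ((D.isRepresentative x).smul c) } }
  opB :=
    { domain := D.domain
      toFun :=
        { toFun := fun x => WithLp.toLp 2 (fun j : Fin m => D.rep x (Sum.inr j) 0)
          map_add' := fun x x' => by
            ext j
            exact D.rep_add_zero x x' (Sum.inr j)
          map_smul' := fun c x => by
            ext j
            exact D.rep_smul_zero c x (Sum.inr j) } }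
  domain_le := le_rfl
  opC :=
    { toFun := fun x => WithLp.toLp 2 (fun k : Fin p => D.rep x (Sum.inl k) 0)
      map_add' := fun x x' => by
        ext k
        exact D.rep_add_zero x x' (Sum.inl k)
      map_smul' := fun c x => by
        ext k
        exact D.rep_smul_zero c x (Sum.inl k) }

end SignedDiagonal

end

/-!
Integrating `Re ⟨Δx, (Δx)'⟩` over `[0, N]` gives `‖(Δx)(N)‖²` minus `‖(Δx)(0)‖²` in each component.
The term at `N` tends to a limit, which is `0` because `‖(Δx)(ξ)‖² / |Δ(ξ)|` is integrable while the
travel time `∫₀^∞ dξ / |Δ(ξ)|` is infinite. This leaves the energy identity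
`2 Re ⟨x, 𝒜x⟩ = ‖ℬx‖² - ‖𝒞x‖²`, from which dissipativity of `A`, the energy balance, uniqueness and
well-posedness follow. Variation of constants in the travel time inverts `s - A` for `Re s > 0`, so
`A` generates a contraction semigroup by Lumer–Phillips, and Duhamel's formula for `x - Bu` yields
classical solutions.

`G(s)u` is the output of a solution of `𝒜x = sx`. There is no spectral parameter with `Re s < 0` in
`ρ(A)`, since outgoing components then have decaying exponentials as eigenfunctions; for
`Re s ≥ 0` the energy identity of a single outgoing component forces its boundary value to vanish.
-/

section Dissipative

open scoped InnerProductSpace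

variable {X : Type*} [NormedAddCommGroup X] [InnerProductSpace ℂ X] {A : X →ₗ.[ℂ] X}

/-- A partially defined operator `A` with `Re ⟨x, A x⟩ ≤ 0` on its domain. -/
def IsDissipative (A : X →ₗ.[ℂ] X) : Prop :=
  ∀ x : A.domain, (⟪(x : X), A x⟫_ℂ).re ≤ 0

/-- An `m`-dissipative operator. The range condition is imposed on the whole open right half-plane
rather than at a single point, which spares the perturbation argument. -/
structure IsMaximalDissipative (A : X →ₗ.[ℂ] X) : Prop where
  isDissipative : IsDissipative A
  surjective : ∀ s : ℂ, 0 < s.re → Function.Surjective fun x : A.domain => s • (x : X) - A x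

theorem IsDissipative.re_mul_norm_le (hA : IsDissipative A) (s : ℂ) (x : A.domain) :
    s.re * ‖(x : X)‖ ≤ ‖s • (x : X) - A x‖ := by
  have hinner : (⟪(x : X), s • (x : X) - A x⟫_ℂ).re =
      s.re * ‖(x : X)‖ ^ 2 - (⟪(x : X), A x⟫_ℂ).re := by
    rw [inner_sub_right, inner_smul_right, inner_self_eq_norm_sq_to_K]
    simp [← Complex.ofReal_pow]
  have hcauchy : (⟪(x : X), s • (x : X) - A x⟫_ℂ).re ≤ ‖(x : X)‖ * ‖s • (x : X) - A x‖ :=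
    re_inner_le_norm (𝕜 := ℂ) _ _
  have hx := hA x
  rcases (norm_nonneg (x : X)).eq_or_lt with h | h
  · simp [← h]
  · nlinarith

theorem IsDissipative.injective_smul_sub (hA : IsDissipative A) {s : ℂ} (hs : 0 < s.re) :
    Function.Injective (s • A.domain.subtype - A.toFun) := by
  refine (injective_iff_map_eq_zero _).2 fun x hx => ?_
  have hle : s.re * ‖(x : X)‖ ≤ 0 := by
    have := hA.re_mul_norm_le s x
    rwa [show s • (x : X) - A x = 0 from hx, norm_zero] at this
  exact Subtype.ext (norm_le_zero_iff.1 (nonpos_of_mul_nonpos_right hle hs))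

namespace IsMaximalDissipative

theorem exists_isResolventAt (hA : IsMaximalDissipative A) {s : ℂ} (hs : 0 < s.re) :
    ∃ R : X →L[ℂ] X, IsResolventAt A s R ∧ ∀ y, s.re * ‖R y‖ ≤ ‖y‖ := by
  let e : A.domain ≃ₗ[ℂ] X := LinearEquiv.ofBijective (s • A.domain.subtype - A.toFun)
    ⟨hA.isDissipative.injective_smul_sub hs, hA.surjective s hs⟩
  have he : ∀ x : A.domain, e x = s • (x : X) - A x := fun _ => rfl
  have hnorm : ∀ y, s.re * ‖(e.symm y : X)‖ ≤ ‖y‖ := fun y => by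
    simpa only [← he, e.apply_symm_apply] using hA.isDissipative.re_mul_norm_le s (e.symm y)
  refine ⟨(A.domain.subtype ∘ₗ e.symm.toLinearMap).mkContinuous s.re⁻¹ fun y => ?_,
    ⟨fun y => ⟨(e.symm y).2, e.apply_symm_apply y⟩, fun x => ?_⟩, hnorm⟩
  · rw [← div_eq_inv_mul, le_div_iff₀' hs]
    exact hnorm y
  · exact congrArg Subtype.val (e.symm_apply_apply x)

theorem mem_unboundedResolventSet (hA : IsMaximalDissipative A) {s : ℂ} (hs : 0 < s.re) :
    s ∈ unboundedResolventSet A :=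
  let ⟨R, hR, _⟩ := hA.exists_isResolventAt hs
  ⟨R, hR⟩

theorem dense_domain [CompleteSpace X] (hA : IsMaximalDissipative A) :
    Dense (A.domain : Set X) := by
  rw [Submodule.dense_iff_topologicalClosure_eq_top, Submodule.topologicalClosure_eq_top_iff,
    Submodule.eq_bot_iff]
  intro y hy
  obtain ⟨x, rfl⟩ := hA.surjective 1 (by simp) y
  have horth : ⟪(x : X), (1 : ℂ) • (x : X) - A x⟫_ℂ = 0 :=
    (Submodule.mem_orthogonal _ _).1 hy x x.2
  have hnorm : ‖(x : X)‖ ^ 2 = (⟪(x : X), A x⟫_ℂ).re := by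
    rw [one_smul, inner_sub_right, inner_self_eq_norm_sq_to_K, sub_eq_zero] at horth
    simp [← horth, ← Complex.ofReal_pow]
  have hx : x = 0 := by
    have hzero : ‖(x : X)‖ = 0 := by nlinarith [hA.isDissipative x, norm_nonneg (x : X)]
    exact Subtype.ext (norm_eq_zero.1 hzero)
  simp [hx]

end IsMaximalDissipative

end Dissipative

section Resolvent

variable {X : Type*} [NormedAddCommGroup X] [NormedSpace ℂ X] {A : X →ₗ.[ℂ] X}
  {s t : ℂ} {R S : X →L[ℂ] X}

namespace IsResolventAt

theorem resolvent_identity (hR : IsResolventAt A s R) (hS : IsResolventAt A t S) (y : X) :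
    S y = (s - t) • R (S y) + R y := by
  obtain ⟨hmem, heq⟩ := hS.1 y
  have hshift : s • S y - A ⟨S y, hmem⟩ = (s - t) • S y + y := by
    linear_combination (norm := module) heq
  have hinv := hR.2 ⟨S y, hmem⟩
  rw [hshift, map_add, map_smul] at hinv
  exact hinv.symm

theorem commute (hR : IsResolventAt A s R) (hS : IsResolventAt A t S) : Commute R S := by
  obtain rfl | hst := eq_or_ne s t
  · have hRS : S = R := by
      ext y
      simpa using hR.resolvent_identity hS y
    exact hRS ▸ Commute.refl S
  ext y
  have hcomm : (s - t) • R (S y) = (s - t) • S (R y) := by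
    linear_combination (norm := module) -hR.resolvent_identity hS y - hS.resolvent_identity hR y
  exact smul_right_injective X (sub_ne_zero.2 hst) hcomm

end IsResolventAt

end Resolvent

section ContractionSemigroup

open scoped InnerProductSpace

/-- A `C₀`-semigroup of contractions. The irrelevant operators `T t` with `t < 0` are frozen to
`T 0`, so that the orbits are continuous on all of `ℝ`. -/
structure IsContractionSemigroup {X : Type*} [NormedAddCommGroup X] [NormedSpace ℂ X]
    (T : ℝ → X →L[ℂ] X) : Prop extends IsC0Semigroup T where
  norm_apply_le : ∀ t x, ‖T t x‖ ≤ ‖x‖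
  map_max_zero : ∀ t, T (max t 0) = T t

theorem tendsto_of_dense_of_norm_le {𝕜 E F ι : Type*} [NontriviallyNormedField 𝕜]
    [SeminormedAddCommGroup E] [NormedSpace 𝕜 E] [SeminormedAddCommGroup F] [NormedSpace 𝕜 F]
    {l : Filter ι} {S : ι → E →L[𝕜] F} {K : ℝ} (hS : ∀ i x, ‖S i x‖ ≤ K * ‖x‖)
    {D : Set E} (hD : Dense D) {f : E → F} (hf : Continuous f)
    (h : ∀ x ∈ D, Tendsto (fun i => S i x) l (𝓝 (f x))) (x : E) :
    Tendsto (fun i => S i x) l (𝓝 (f x)) := by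
  have hlip : ∀ i, LipschitzWith K.toNNReal (S i) := fun i =>
    AddMonoidHomClass.lipschitz_of_bound (S i) K (hS i)
  have hclosed : IsClosed {x | Tendsto (fun i => S i x) l (𝓝 (f x))} :=
    (LipschitzWith.uniformEquicontinuous _ _ hlip).equicontinuous.isClosed_setOfPred_tendsto hf
  exact hclosed.closure_subset_iff.2 h (hD x)

theorem tendsto_contraction_apply {𝕜 E F ι : Type*} [NontriviallyNormedField 𝕜]
    [SeminormedAddCommGroup E] [NormedSpace 𝕜 E] [SeminormedAddCommGroup F] [NormedSpace 𝕜 F]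
    {l : Filter ι} {S : ι → E →L[𝕜] F} (hS : ∀ i x, ‖S i x‖ ≤ ‖x‖) {v : ι → E} {y : E} {z : F}
    (hy : Tendsto (fun i => S i y) l (𝓝 z)) (hv : Tendsto v l (𝓝 y)) :
    Tendsto (fun i => S i (v i)) l (𝓝 z) := by
  have hdiff : Tendsto (fun i => S i (v i - y)) l (𝓝 0) :=
    squeeze_zero_norm (fun i => hS i _) (tendsto_iff_norm_sub_tendsto_zero.1 hv)
  simpa using hdiff.add hy

namespace IsContractionSemigroup

variable {X : Type*} [NormedAddCommGroup X]

section

variable [NormedSpace ℂ X] {T : ℝ → X →L[ℂ] X}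

theorem norm_apply_sub_apply_le (hT : IsContractionSemigroup T) (s t : ℝ) (x : X) :
    ‖T t x - T s x‖ ≤ ‖T |max t 0 - max s 0| x - x‖ := by
  rw [← hT.map_max_zero s, ← hT.map_max_zero t]
  wlog hst : max s 0 ≤ max t 0 generalizing s t
  · rw [norm_sub_rev, abs_sub_comm]
    exact this t s (le_of_not_ge hst)
  calc ‖T (max t 0) x - T (max s 0) x‖
      = ‖T (max s 0) (T (max t 0 - max s 0) x - x)‖ := by
        rw [map_sub, ← ContinuousLinearMap.comp_apply,
          ← hT.map_add _ _ (le_max_right s 0) (sub_nonneg.2 hst), add_sub_cancel]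
    _ ≤ ‖T |max t 0 - max s 0| x - x‖ := by
        rw [abs_of_nonneg (sub_nonneg.2 hst)]
        exact hT.norm_apply_le _ _

theorem continuous_apply (hT : IsContractionSemigroup T) (x : X) : Continuous fun t => T t x := by
  have hleft : Tendsto (fun r => T r x) (𝓝[≤] 0) (𝓝 x) := by
    refine tendsto_const_nhds.congr' ?_
    filter_upwards [self_mem_nhdsWithin] with r (hr : r ≤ 0)
    rw [← hT.map_max_zero, max_eq_right hr, hT.map_zero, ContinuousLinearMap.id_apply]
  have hzero : Tendsto (fun r => T r x) (𝓝 0) (𝓝 x) := by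
    rw [← nhdsLE_sup_nhdsGT]
    exact hleft.sup (hT.strongly_continuous x)
  refine continuous_iff_continuousAt.2 fun s => ?_
  have hdist : Tendsto (fun t : ℝ => |max t 0 - max s 0|) (𝓝 s) (𝓝 0) := by
    have : Continuous fun t : ℝ => |max t 0 - max s 0| := by fun_prop
    simpa using this.tendsto s
  exact tendsto_iff_norm_sub_tendsto_zero.2 <|
    squeeze_zero (fun _ => norm_nonneg _) (fun t => hT.norm_apply_sub_apply_le s t x)
      (tendsto_iff_norm_sub_tendsto_zero.1 (hzero.comp hdist))

theorem continuous_uncurry (hT : IsContractionSemigroup T) :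
    Continuous fun q : ℝ × X => T q.1 q.2 :=
  continuous_iff_continuousAt.2 fun q =>
    tendsto_contraction_apply (S := fun q : ℝ × X => T q.1) (fun _ => hT.norm_apply_le _)
      ((hT.continuous_apply q.2).comp continuous_fst).continuousAt continuousAt_snd

end

theorem re_inner_nonpos [InnerProductSpace ℂ X] {T : ℝ → X →L[ℂ] X}
    (hT : IsContractionSemigroup T) {x y : X}
    (h : Tendsto (fun t : ℝ => ((t : ℂ)⁻¹) • (T t x - x)) (𝓝[>] 0) (𝓝 y)) :
    (⟪x, y⟫_ℂ).re ≤ 0 := by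
  refine le_of_tendsto ((Complex.continuous_re.tendsto _).comp
    (tendsto_const_nhds.inner h)) ?_
  filter_upwards [self_mem_nhdsWithin] with t (ht : 0 < t)
  have hcauchy : (⟪x, T t x⟫_ℂ).re ≤ ‖x‖ * ‖x‖ :=
    (re_inner_le_norm (𝕜 := ℂ) x (T t x)).trans (by gcongr; exact hT.norm_apply_le t x)
  have hself : (⟪x, x⟫_ℂ).re = ‖x‖ * ‖x‖ :=
    inner_self_eq_norm_mul_norm (𝕜 := ℂ) x
  rw [Function.comp_apply, inner_smul_right, inner_sub_right, ← Complex.ofReal_inv,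
    Complex.re_ofReal_mul, Complex.sub_re, hself]
  exact mul_nonpos_of_nonneg_of_nonpos (inv_nonneg.2 ht.le) (sub_nonpos.2 hcauchy)

end IsContractionSemigroup

theorem IsMaximalDissipative.isGeneratorOf {X : Type*} [NormedAddCommGroup X]
    [InnerProductSpace ℂ X] {A : X →ₗ.[ℂ] X} {T : ℝ → X →L[ℂ] X} (hA : IsMaximalDissipative A)
    (hT : IsContractionSemigroup T)
    (h : ∀ x : A.domain, Tendsto (fun t : ℝ => ((t : ℂ)⁻¹) • (T t x - x)) (𝓝[>] 0) (𝓝 (A x))) :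
    IsGeneratorOf A T := by
  refine fun x y => ⟨fun hxy => ?_, fun hxy => ?_⟩
  · obtain ⟨x, rfl, rfl⟩ := (LinearPMap.mem_graph_iff A).1 hxy
    exact h x
  obtain ⟨x', hx'⟩ := hA.surjective 1 (by simp) (x - y)
  -- `x - x'` is an eigenvector of the (dissipative) generator of `T` for the eigenvalue `1`.
  have heigen : Tendsto (fun t : ℝ => ((t : ℂ)⁻¹) • (T t (x - x') - (x - x'))) (𝓝[>] 0)
      (𝓝 (x - x')) := by
    have hdiff := hxy.sub (h x')
    rw [show y - A x' = x - x' by linear_combination (norm := module) hx'] at hdiff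
    refine hdiff.congr fun t => ?_
    rw [map_sub]
    module
  have hnorm : ‖x - x'‖ * ‖x - x'‖ ≤ 0 := by
    rw [← inner_self_eq_norm_mul_norm (𝕜 := ℂ)]
    exact hT.re_inner_nonpos heigen
  obtain rfl : x = x' := sub_eq_zero.1 (norm_eq_zero.1 (mul_self_eq_zero.1
    (hnorm.antisymm (mul_self_nonneg _))))
  have hAx : A x' = y := by
    linear_combination (norm := module) -hx'
  exact hAx ▸ A.mem_graph x'

end ContractionSemigroup

section LumerPhillips

open scoped InnerProductSpace
open NormedSpace (exp)

variable {X : Type*} [NormedAddCommGroup X] [InnerProductSpace ℂ X]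

section BoundedDissipative

variable [CompleteSpace X] {L M : X →L[ℂ] X}

theorem hasDerivAt_exp_smul_apply (L : X →L[ℂ] X) (x : X) (t : ℝ) :
    HasDerivAt (fun r : ℝ => exp (r • L) x) (exp (t • L) (L x)) t :=
  ((ContinuousLinearMap.apply ℂ X x).restrictScalars ℝ).hasFDerivAt.comp_hasDerivAt t
    (hasDerivAt_exp_smul_const (𝕂 := ℝ) L t)

theorem hasDerivAt_exp_smul_apply' (L : X →L[ℂ] X) (x : X) (t : ℝ) :
    HasDerivAt (fun r : ℝ => exp (r • L) x) (L (exp (t • L) x)) t :=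
  ((ContinuousLinearMap.apply ℂ X x).restrictScalars ℝ).hasFDerivAt.comp_hasDerivAt t
    (hasDerivAt_exp_smul_const' (𝕂 := ℝ) L t)

theorem exp_add_smul_apply (L : X →L[ℂ] X) (s t : ℝ) (x : X) :
    exp ((s + t) • L) x = exp (s • L) (exp (t • L) x) := by
  let := NormedAlgebra.restrictScalars ℚ ℝ (X →L[ℂ] X)
  rw [add_smul, NormedSpace.exp_add_of_commute (((Commute.refl L).smul_left s).smul_right t)]
  rfl

theorem norm_exp_smul_apply_le (hL : ∀ x, (⟪x, L x⟫_ℂ).re ≤ 0) {t : ℝ} (ht : 0 ≤ t) (x : X) :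
    ‖exp (t • L) x‖ ≤ ‖x‖ := by
  let := InnerProductSpace.rclikeToReal ℂ X
  have hderiv : ∀ r : ℝ, HasDerivAt (fun r : ℝ => ‖exp (r • L) x‖ ^ 2)
      (2 * (⟪exp (r • L) x, L (exp (r • L) x)⟫_ℂ).re) r :=
    fun r => (hasDerivAt_exp_smul_apply' L x r).norm_sq
  have hanti : Antitone fun r : ℝ => ‖exp (r • L) x‖ ^ 2 :=
    antitone_of_hasDerivAt_nonpos hderiv fun r => by
      exact mul_nonpos_of_nonneg_of_nonpos two_pos.le (hL _)
  have hle := hanti ht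
  simp only [zero_smul, NormedSpace.exp_zero, one_apply_eq_self] at hle
  exact le_of_sq_le_sq hle (norm_nonneg _)

theorem hasDerivAt_exp_smul_exp_sub_smul_apply (hLM : Commute L M) (t r : ℝ) (x : X) :
    HasDerivAt (fun r : ℝ => exp (r • L) (exp ((t - r) • M) x))
      (exp (r • L) (exp ((t - r) • M) (L x - M x))) r := by
  have hcomm : Commute (exp ((t - r) • M)) (L - M) :=
    ((hLM.sub_left (Commute.refl M)).symm.smul_left (t - r)).exp_left
  have hexpM : HasDerivAt (fun r : ℝ => exp ((t - r) • M)) (-(M * exp ((t - r) • M))) r := by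
    simpa [Function.comp_def] using (hasDerivAt_exp_smul_const' (𝕂 := ℝ) M (t - r)).scomp r
      ((hasDerivAt_id r).const_sub t)
  refine (((ContinuousLinearMap.apply ℂ X x).restrictScalars ℝ).hasFDerivAt.comp_hasDerivAt r
    ((hasDerivAt_exp_smul_const (𝕂 := ℝ) L r).mul hexpM)).congr_deriv ?_
  have happly := DFunLike.congr_fun hcomm.eq x
  simp only [mul_apply_eq_comp, sub_apply] at happly
  rw [happly]
  simp [sub_eq_add_neg]

theorem norm_exp_smul_sub_exp_smul_apply_le (hL : ∀ x, (⟪x, L x⟫_ℂ).re ≤ 0)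
    (hM : ∀ x, (⟪x, M x⟫_ℂ).re ≤ 0) (hLM : Commute L M) {t : ℝ} (ht : 0 ≤ t) (x : X) :
    ‖exp (t • L) x - exp (t • M) x‖ ≤ t * ‖L x - M x‖ := by
  have hbound : ∀ r ∈ Ico 0 t, ‖exp (r • L) (exp ((t - r) • M) (L x - M x))‖ ≤ ‖L x - M x‖ :=
    fun r hr => (norm_exp_smul_apply_le hL hr.1 _).trans
      (norm_exp_smul_apply_le hM (sub_nonneg.2 hr.2.le) _)
  simpa [mul_comm] using norm_image_sub_le_of_norm_deriv_le_segment'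
    (fun r _ => (hasDerivAt_exp_smul_exp_sub_smul_apply hLM t r x).hasDerivWithinAt) hbound
    t ⟨ht, le_rfl⟩

end BoundedDissipative

section Yosida

variable {A : X →ₗ.[ℂ] X} {s t : ℂ} {R S : X →L[ℂ] X}

/-- The Yosida approximation `s A (s - A)⁻¹ = s (s (s - A)⁻¹ - 1)`, in terms of the resolvent
`R = (s - A)⁻¹`. -/
def yosidaApprox (s : ℂ) (R : X →L[ℂ] X) : X →L[ℂ] X := s • (s • R - 1)

theorem re_inner_yosidaApprox_nonpos {s : ℝ} (hs : 0 ≤ s) (hR : ∀ x, s * ‖R x‖ ≤ ‖x‖) (x : X) :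
    (⟪x, yosidaApprox s R x⟫_ℂ).re ≤ 0 := by
  have hcauchy : (⟪x, (s : ℂ) • R x⟫_ℂ).re ≤ ‖x‖ * ‖x‖ := by
    refine (re_inner_le_norm (𝕜 := ℂ) x _).trans ?_
    rw [norm_smul, Complex.norm_of_nonneg hs]
    gcongr
    exact hR x
  have hself : (⟪x, x⟫_ℂ).re = ‖x‖ * ‖x‖ :=
    inner_self_eq_norm_mul_norm (𝕜 := ℂ) x
  simp only [yosidaApprox, smul_apply, sub_apply, one_apply_eq_self]
  rw [inner_smul_right, Complex.re_ofReal_mul, inner_sub_right, Complex.sub_re, hself]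
  exact mul_nonpos_of_nonneg_of_nonpos hs (sub_nonpos.2 hcauchy)

theorem commute_yosidaApprox (h : Commute R S) (s t : ℂ) :
    Commute (yosidaApprox s R) (yosidaApprox t S) :=
  ((((h.smul_left s).smul_right t).sub_right (Commute.one_right _)).sub_left
    (Commute.one_left _)).smul_left s |>.smul_right t

theorem IsResolventAt.smul_apply_sub (hR : IsResolventAt A s R) (x : A.domain) :
    s • R x - x = R (A x) := by
  have hinv := hR.2 x
  rw [map_sub, map_smul] at hinv
  linear_combination (norm := module) hinv

theorem IsResolventAt.yosidaApprox_apply (hR : IsResolventAt A s R) (x : A.domain) :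
    yosidaApprox s R x = s • R (A x) := by
  simp only [yosidaApprox, smul_apply, sub_apply, one_apply_eq_self, hR.smul_apply_sub]

/-- A sequence of commuting bounded dissipative operators that converges to `A` on the domain
of `A`. -/
structure IsDissipativeApprox (A : X →ₗ.[ℂ] X) (L : ℕ → X →L[ℂ] X) : Prop where
  re_inner_nonpos : ∀ n x, (⟪x, L n x⟫_ℂ).re ≤ 0
  commute : ∀ m n, Commute (L m) (L n)
  tendsto : ∀ x : A.domain, Tendsto (fun n => L n x) atTop (𝓝 (A x))

theorem tendsto_smul_resolvent_apply {c : ℕ → ℝ} {R : ℕ → X →L[ℂ] X} (hc : ∀ n, 0 < c n)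
    (hclim : Tendsto c atTop atTop) (hA : Dense (A.domain : Set X))
    (hR : ∀ n, IsResolventAt A (c n) (R n)) (hRn : ∀ n x, c n * ‖R n x‖ ≤ ‖x‖) (x : X) :
    Tendsto (fun n => (c n : ℂ) • R n x) atTop (𝓝 x) := by
  refine tendsto_of_dense_of_norm_le (S := fun n => (c n : ℂ) • R n) (K := 1) (fun n y => ?_) hA
    continuous_id (fun y hy => ?_) x
  · rw [smul_apply, norm_smul, Complex.norm_of_nonneg (hc n).le, one_mul]
    exact hRn n y
  · have hle : ∀ n, ‖(c n : ℂ) • R n y - y‖ ≤ ‖A ⟨y, hy⟩‖ * (c n)⁻¹ := fun n => by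
      rw [(hR n).smul_apply_sub ⟨y, hy⟩, ← div_eq_mul_inv, le_div_iff₀' (hc n)]
      exact hRn n _
    refine tendsto_iff_norm_sub_tendsto_zero.2 (squeeze_zero (fun _ => norm_nonneg _) hle ?_)
    simpa using hclim.inv_tendsto_atTop.const_mul ‖A ⟨y, hy⟩‖

theorem IsMaximalDissipative.exists_isDissipativeApprox [CompleteSpace X]
    (hA : IsMaximalDissipative A) :
    ∃ L : ℕ → X →L[ℂ] X, IsDissipativeApprox A L := by
  let c : ℕ → ℝ := fun n => n + 1
  have hc : ∀ n, 0 < c n := fun n => Nat.cast_add_one_pos n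
  have hclim : Tendsto c atTop atTop :=
    tendsto_atTop_add_const_right _ 1 tendsto_natCast_atTop_atTop
  choose R hR hRn using fun n => hA.exists_isResolventAt (s := c n) (by exact_mod_cast hc n)
  simp only [Complex.ofReal_re] at hRn
  refine ⟨fun n => yosidaApprox (c n) (R n),
    fun n => re_inner_yosidaApprox_nonpos (hc n).le (hRn n),
    fun m n => commute_yosidaApprox ((hR m).commute (hR n)) _ _, fun x => ?_⟩
  simp only [(hR _).yosidaApprox_apply]
  exact tendsto_smul_resolvent_apply hc hclim hA.dense_domain hR hRn (A x)

end Yosida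

/-- `T t` is the strong limit of the exponentials `exp (t L n)` for `t ≥ 0`, frozen at negative
times. -/
def IsExpLimit (L : ℕ → X →L[ℂ] X) (T : ℝ → X →L[ℂ] X) : Prop :=
  ∀ t x, Tendsto (fun n => exp (max t 0 • L n) x) atTop (𝓝 (T t x))

variable {A : X →ₗ.[ℂ] X} {L : ℕ → X →L[ℂ] X} {T : ℝ → X →L[ℂ] X}

namespace IsExpLimit

theorem map_zero (hT : IsExpLimit L T) : T 0 = ContinuousLinearMap.id ℂ X := by
  ext x
  refine tendsto_nhds_unique (hT 0 x) ?_
  simp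

theorem map_max_zero (hT : IsExpLimit L T) (t : ℝ) : T (max t 0) = T t := by
  ext x
  refine tendsto_nhds_unique ?_ (hT t x)
  simpa using hT (max t 0) x

end IsExpLimit

variable [CompleteSpace X]

namespace IsDissipativeApprox

theorem cauchySeq_exp_smul_apply (hL : IsDissipativeApprox A L)
    (hA : Dense (A.domain : Set X)) {t : ℝ} (ht : 0 ≤ t) (x : X) :
    CauchySeq fun n => exp (t • L n) x := by
  rw [cauchySeq_iff_tendsto_dist_atTop_0]
  simp only [dist_eq_norm]
  refine tendsto_zero_iff_norm_tendsto_zero.1 (tendsto_of_dense_of_norm_le (K := 2)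
    (S := fun q : ℕ × ℕ => exp (t • L q.1) - exp (t • L q.2)) (fun q y => ?_) hA
    continuous_const (fun y hy => ?_) x)
  · calc ‖exp (t • L q.1) y - exp (t • L q.2) y‖
        ≤ ‖exp (t • L q.1) y‖ + ‖exp (t • L q.2) y‖ := norm_sub_le _ _
      _ ≤ ‖y‖ + ‖y‖ := add_le_add (norm_exp_smul_apply_le (hL.re_inner_nonpos _) ht y)
          (norm_exp_smul_apply_le (hL.re_inner_nonpos _) ht y)
      _ = 2 * ‖y‖ := (two_mul _).symm
  · have hcauchy := cauchySeq_iff_tendsto_dist_atTop_0.1 (hL.tendsto ⟨y, hy⟩).cauchySeq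
    simp only [dist_eq_norm] at hcauchy
    exact squeeze_zero_norm (fun q => norm_exp_smul_sub_exp_smul_apply_le (hL.re_inner_nonpos _)
      (hL.re_inner_nonpos _) (hL.commute _ _) ht y) (by simpa using hcauchy.const_mul t)

theorem exists_isExpLimit (hL : IsDissipativeApprox A L) (hA : Dense (A.domain : Set X)) :
    ∃ T : ℝ → X →L[ℂ] X, IsExpLimit L T := by
  choose f hf using fun t x => cauchySeq_tendsto_of_complete
    (hL.cauchySeq_exp_smul_apply hA (le_max_right t 0) x)
  exact ⟨fun t => continuousLinearMapOfTendsto _ (tendsto_pi_nhds.2 (hf t)), hf⟩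

end IsDissipativeApprox

namespace IsExpLimit

theorem norm_apply_le (hT : IsExpLimit L T) (hL : ∀ n x, (⟪x, L n x⟫_ℂ).re ≤ 0) (t : ℝ) (x : X) :
    ‖T t x‖ ≤ ‖x‖ :=
  le_of_tendsto (hT t x).norm
    (Eventually.of_forall fun n => norm_exp_smul_apply_le (hL n) (le_max_right _ _) x)

theorem map_add (hT : IsExpLimit L T) (hL : ∀ n x, (⟪x, L n x⟫_ℂ).re ≤ 0) {s t : ℝ} (hs : 0 ≤ s)
    (ht : 0 ≤ t) : T (s + t) = (T s).comp (T t) := by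
  ext x
  refine tendsto_nhds_unique (hT (s + t) x) ?_
  have hlim : Tendsto (fun n => exp (max s 0 • L n) (exp (max t 0 • L n) x)) atTop
      (𝓝 (T s (T t x))) :=
    tendsto_contraction_apply
      (fun n => norm_exp_smul_apply_le (hL n) (le_max_right _ _)) (hT s (T t x)) (hT t x)
  simpa only [← exp_add_smul_apply, max_eq_left hs, max_eq_left ht, max_eq_left (add_nonneg hs ht),
    ContinuousLinearMap.comp_apply] using hlim

theorem apply_eq_add_integral (hT : IsExpLimit L T) (hL : IsDissipativeApprox A L)
    (x : A.domain) {t : ℝ} (ht : 0 ≤ t) : T t x = x + ∫ s in (0 : ℝ)..t, T s (A x) := by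
  have hcont : ∀ n, Continuous fun s : ℝ => exp (s • L n) (L n x) := fun n =>
    continuous_iff_continuousAt.2 fun s => (hasDerivAt_exp_smul_apply (L n) _ s).continuousAt
  have hFTC : ∀ n, exp (t • L n) (x : X) = x + ∫ s in (0 : ℝ)..t, exp (s • L n) (L n x) := by
    intro n
    rw [intervalIntegral.integral_eq_sub_of_hasDerivAt
      (fun s _ => hasDerivAt_exp_smul_apply (L n) (x : X) s) ((hcont n).intervalIntegrable 0 t)]
    simp
  obtain ⟨C, hC⟩ := (hL.tendsto x).norm.bddAbove_range
  have hdom : Tendsto (fun n => ∫ s in (0 : ℝ)..t, exp (s • L n) (L n x)) atTop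
      (𝓝 (∫ s in (0 : ℝ)..t, T s (A x))) := by
    refine intervalIntegral.tendsto_integral_filter_of_dominated_convergence (fun _ => C)
      (Eventually.of_forall fun n => (hcont n).aestronglyMeasurable)
      (Eventually.of_forall fun n => Eventually.of_forall fun s hs => ?_) (by simp)
      (Eventually.of_forall fun s hs => ?_) <;> rw [uIoc_of_le ht] at hs
    · exact (norm_exp_smul_apply_le (hL.re_inner_nonpos n) hs.1.le _).trans (hC ⟨n, rfl⟩)
    · have hs_apply := hT s (A x)
      rw [max_eq_left hs.1.le] at hs_apply
      exact tendsto_contraction_apply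
        (fun n => norm_exp_smul_apply_le (hL.re_inner_nonpos n) hs.1.le) hs_apply (hL.tendsto x)
  have ht_apply := hT t x
  simp only [max_eq_left ht, hFTC] at ht_apply
  exact tendsto_nhds_unique ht_apply (hdom.const_add _)

theorem norm_apply_sub_le (hT : IsExpLimit L T) (hL : IsDissipativeApprox A L) (x : A.domain)
    {t : ℝ} (ht : 0 ≤ t) : ‖T t x - x‖ ≤ ‖A x‖ * t := by
  rw [hT.apply_eq_add_integral hL x ht, add_sub_cancel_left]
  simpa [abs_of_nonneg ht] using intervalIntegral.norm_integral_le_of_norm_le_const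
    (fun s _ => hT.norm_apply_le hL.re_inner_nonpos s (A x)) (a := 0) (b := t)

theorem isContractionSemigroup (hT : IsExpLimit L T) (hL : IsDissipativeApprox A L)
    (hA : Dense (A.domain : Set X)) : IsContractionSemigroup T where
  map_zero := hT.map_zero
  map_add _ _ := hT.map_add hL.re_inner_nonpos
  norm_apply_le := hT.norm_apply_le hL.re_inner_nonpos
  map_max_zero := hT.map_max_zero
  strongly_continuous := by
    refine tendsto_of_dense_of_norm_le (K := 1)
      (fun t x => by simpa using hT.norm_apply_le hL.re_inner_nonpos t x) hA continuous_id
      fun x hx => tendsto_iff_norm_sub_tendsto_zero.2 ?_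
    have hlim : Tendsto (fun t : ℝ => ‖A ⟨x, hx⟩‖ * t) (𝓝[>] 0) (𝓝 0) :=
      (Continuous.tendsto' (by fun_prop) 0 0 (by simp)).mono_left nhdsWithin_le_nhds
    refine squeeze_zero' (Eventually.of_forall fun _ => norm_nonneg _) ?_ hlim
    filter_upwards [self_mem_nhdsWithin] with t (ht : 0 < t)
    exact hT.norm_apply_sub_le hL ⟨x, hx⟩ ht.le

theorem tendsto_difference_quotient (hT : IsExpLimit L T) (hL : IsDissipativeApprox A L)
    (hA : Dense (A.domain : Set X)) (x : A.domain) :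
    Tendsto (fun t : ℝ => ((t : ℂ)⁻¹) • (T t x - x)) (𝓝[>] 0) (𝓝 (A x)) := by
  have hslope := ((((hT.isContractionSemigroup hL hA).continuous_apply (A x)
    ).integral_hasStrictDerivAt 0 0).hasDerivAt).tendsto_slope_zero_right
  rw [hT.map_zero, ContinuousLinearMap.id_apply] at hslope
  refine hslope.congr' ?_
  filter_upwards [self_mem_nhdsWithin] with t (ht : 0 < t)
  rw [zero_add, intervalIntegral.integral_same, sub_zero, hT.apply_eq_add_integral hL x ht.le,
    add_sub_cancel_left, ← Complex.ofReal_inv, Complex.coe_smul]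

end IsExpLimit

/-- **Lumer–Phillips theorem** -/
theorem IsMaximalDissipative.exists_isContractionSemigroup (hA : IsMaximalDissipative A) :
    ∃ T : ℝ → X →L[ℂ] X, IsContractionSemigroup T ∧ IsGeneratorOf A T := by
  obtain ⟨L, hL⟩ := hA.exists_isDissipativeApprox
  obtain ⟨T, hT⟩ := hL.exists_isExpLimit hA.dense_domain
  have hT' := hT.isContractionSemigroup hL hA.dense_domain
  exact ⟨T, hT', hA.isGeneratorOf hT' (hT.tendsto_difference_quotient hL hA.dense_domain)⟩

end LumerPhillips

section Duhamel

variable {X : Type*} [NormedAddCommGroup X] [NormedSpace ℂ X]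
  {A : X →ₗ.[ℂ] X} {T : ℝ → X →L[ℂ] X} {F F' : ℝ → X}

theorem IsGeneratorOf.map_mem_graph (hA : IsGeneratorOf A T) (hT : IsC0Semigroup T)
    {x y : X} (h : (x, y) ∈ A.graph) {t : ℝ} (ht : 0 ≤ t) :
    (T t x, T t y) ∈ A.graph := by
  rw [hA]
  refine (((T t).continuous.tendsto y).comp ((hA x y).1 h)).congr' ?_
  filter_upwards [self_mem_nhdsWithin] with r (hr : 0 < r)
  have hcomm : T r (T t x) = T t (T r x) := by
    rw [← ContinuousLinearMap.comp_apply, ← hT.map_add r t hr.le ht, add_comm,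
      hT.map_add t r ht hr.le, ContinuousLinearMap.comp_apply]
  simp only [Function.comp_apply, map_smul, map_sub, hcomm]

theorem IsGeneratorOf.hasDerivWithinAt_Ici_self (hA : IsGeneratorOf A T) (hT : IsC0Semigroup T)
    {x y : X} (h : (x, y) ∈ A.graph) {t : ℝ} (ht : 0 ≤ t) :
    HasDerivWithinAt (fun r => T r x) (T t y) (Ici t) t := by
  rw [← hasDerivWithinAt_Ioi_iff_Ici, hasDerivWithinAt_iff_tendsto_slope' self_notMem_Ioi]
  have hsub : Tendsto (fun q : ℝ => q - t) (𝓝[>] t) (𝓝[>] 0) := by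
    refine tendsto_nhdsWithin_iff.2 ⟨?_, ?_⟩
    · have : Tendsto (fun q : ℝ => q - t) (𝓝 t) (𝓝 (t - t)) := tendsto_id.sub_const t
      rw [sub_self] at this
      exact this.mono_left nhdsWithin_le_nhds
    · filter_upwards [self_mem_nhdsWithin] with q hq
      exact sub_pos.2 (mem_Ioi.1 hq)
  refine ((((T t).continuous.tendsto y).comp ((hA x y).1 h)).comp hsub).congr' ?_
  filter_upwards [self_mem_nhdsWithin] with q (hq : t < q)
  have hqt : T q x = T t (T (q - t) x) := by
    rw [← ContinuousLinearMap.comp_apply, ← hT.map_add t (q - t) ht (sub_nonneg.2 hq.le),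
      add_sub_cancel]
  rw [slope_def_module, hqt, ← map_sub, ← Complex.coe_smul, Complex.ofReal_inv]
  simp only [Function.comp_apply, map_smul]

/-- The mild solution `∫₀ᵗ T (t - r) F(r) dr` of `v' = A v + F`, `v 0 = 0`, written after the
substitution `s = t - r`, which moves the dependence on `t` from the semigroup to `F`. -/
noncomputable def duhamel (T : ℝ → X →L[ℂ] X) (F : ℝ → X) (t : ℝ) : X :=
  ∫ s in (0 : ℝ)..t, T s (F (t - s))

namespace IsContractionSemigroup

theorem continuous_apply_comp_sub (hT : IsContractionSemigroup T) (hF : Continuous F) :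
    Continuous fun q : ℝ × ℝ => T q.2 (F (q.1 - q.2)) :=
  hT.continuous_uncurry.comp (continuous_snd.prodMk (by fun_prop))

theorem intervalIntegrable_apply_sub (hT : IsContractionSemigroup T) (hF : Continuous F)
    (t a b : ℝ) : IntervalIntegrable (fun s => T s (F (t - s))) volume a b :=
  ((hT.continuous_apply_comp_sub hF).comp (Continuous.prodMk_right t)).intervalIntegrable _ _

theorem continuous_duhamel (hT : IsContractionSemigroup T) (hF : Continuous F) :
    Continuous (duhamel T F) :=
  intervalIntegral.continuous_parametric_intervalIntegral_of_continuous
    (hT.continuous_apply_comp_sub hF) continuous_id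

theorem hasDerivAt_integral_apply_add_sub (hT : IsContractionSemigroup T)
    (hF : ∀ t, HasDerivAt F (F' t) t) (hF' : Continuous F') (t : ℝ) :
    HasDerivAt (fun h => ∫ s in (0 : ℝ)..t, T s (F (t + h - s))) (duhamel T F' t) 0 := by
  have hFc : Continuous F := continuous_iff_continuousAt.2 fun t => (hF t).continuousAt
  obtain ⟨C, hC⟩ := (isCompact_Icc (a := -(|t| + 1)) (b := |t| + 1)).exists_bound_of_continuousOn
    hF'.continuousOn
  have hbound (s : ℝ) (hs : s ∈ uIoc 0 t) (h : ℝ) (hh : h ∈ Metric.ball (0 : ℝ) 1) :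
      ‖T s (F' (t + h - s))‖ ≤ C := by
    refine (hT.norm_apply_le _ _).trans (hC _ (mem_Icc.2 (abs_le.1 ?_)))
    rw [Metric.mem_ball, dist_zero_right, Real.norm_eq_abs] at hh
    have hts := abs_sub_right_of_mem_uIcc (uIoc_subset_uIcc hs)
    rw [sub_zero] at hts
    calc |t + h - s| = |(t - s) + h| := by congr 1; ring
      _ ≤ |t - s| + |h| := abs_add_le _ _
      _ ≤ |t| + 1 := by linarith
  have hderiv (s h : ℝ) : HasDerivAt (fun h => T s (F (t + h - s))) (T s (F' (t + h - s))) h := by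
    have hFs : HasDerivAt (fun h => F (t + h - s)) (F' (t + h - s)) h := by
      simpa [Function.comp_def] using
        (hF (t + h - s)).scomp h (((hasDerivAt_id h).const_add t).sub_const s)
    exact ((T s).restrictScalars ℝ).hasFDerivAt.comp_hasDerivAt h hFs
  refine (intervalIntegral.hasDerivAt_integral_of_dominated_loc_of_deriv_le (𝕜 := ℝ)
    (F' := fun h s => T s (F' (t + h - s))) (bound := fun _ => C)
    (Metric.ball_mem_nhds (0 : ℝ) one_pos)
    (Eventually.of_forall fun h =>
      (hT.intervalIntegrable_apply_sub hFc (t + h) 0 t).def'.aestronglyMeasurable)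
    (hT.intervalIntegrable_apply_sub hFc _ _ _)
    (hT.intervalIntegrable_apply_sub hF' (t + 0) 0 t).def'.aestronglyMeasurable
    (Eventually.of_forall fun s hs h hh => hbound s hs h hh) intervalIntegrable_const
    (Eventually.of_forall fun s _ h _ => hderiv s h)).2.congr_deriv (by rw [add_zero]; rfl)

end IsContractionSemigroup

variable [CompleteSpace X]

theorem IsGeneratorOf.apply_eq_add_integral (hA : IsGeneratorOf A T)
    (hT : IsContractionSemigroup T) {x y : X} (h : (x, y) ∈ A.graph) {t : ℝ} (ht : 0 ≤ t) :
    T t x = x + ∫ s in (0 : ℝ)..t, T s y := by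
  have hint (r : ℝ) : HasDerivAt (fun r => ∫ s in (0 : ℝ)..r, T s y) (T r y) r :=
    ((hT.continuous_apply y).integral_hasStrictDerivAt 0 r).hasDerivAt
  have hconst := constant_of_has_deriv_right_zero (a := 0) (b := t)
    (f := fun r => T r x - ∫ s in (0 : ℝ)..r, T s y)
    ((hT.continuous_apply x).sub
      (continuous_iff_continuousAt.2 fun r => (hint r).continuousAt)).continuousOn
    (fun q hq =>
      ((hA.hasDerivWithinAt_Ici_self hT.toIsC0Semigroup h hq.1).sub
        (hint q).hasDerivWithinAt).congr_deriv (sub_self _))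
    t ⟨ht, le_rfl⟩
  simp only [hT.map_zero, ContinuousLinearMap.id_apply, intervalIntegral.integral_same,
    sub_zero] at hconst
  exact sub_eq_iff_eq_add.1 hconst

theorem IsGeneratorOf.hasDerivWithinAt (hA : IsGeneratorOf A T) (hT : IsContractionSemigroup T)
    {x y : X} (h : (x, y) ∈ A.graph) {t : ℝ} (ht : 0 ≤ t) :
    HasDerivWithinAt (fun r => T r x) (T t y) (Ici 0) t :=
  ((((hT.continuous_apply y).integral_hasStrictDerivAt 0 t).hasDerivAt.const_add
    x).hasDerivWithinAt (s := Ici 0)).congr (fun _ hr => hA.apply_eq_add_integral hT h hr)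
    (hA.apply_eq_add_integral hT h ht)

theorem hasDerivAt_integral_add_zero {k : ℝ → ℝ → X} (hk : Continuous (Function.uncurry k))
    (a : ℝ) : HasDerivAt (fun h => ∫ s in a..a + h, k h s) (k 0 a) 0 := by
  rw [hasDerivAt_iff_isLittleO_nhds_zero, Asymptotics.isLittleO_iff]
  intro ε hε
  obtain ⟨δ, hδ, hkδ⟩ := Metric.continuousAt_iff.1 (hk.continuousAt (x := (0, a))) ε hε
  filter_upwards [Metric.ball_mem_nhds (0 : ℝ) hδ] with h hh
  rw [Metric.mem_ball, dist_zero_right, Real.norm_eq_abs] at hh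
  have hint : IntervalIntegrable (k h) volume a (a + h) :=
    (hk.comp (continuous_const.prodMk continuous_id)).intervalIntegrable _ _
  have herr : (∫ s in a..a + (0 + h), k (0 + h) s) - (∫ s in a..a + 0, k 0 s) - h • k 0 a
      = ∫ s in a..a + h, (k h s - k 0 a) := by
    rw [intervalIntegral.integral_sub hint intervalIntegrable_const]
    simp
  rw [herr]
  refine (intervalIntegral.norm_integral_le_of_norm_le_const (C := ε) fun s hs => ?_).trans
    (by simp)
  have hdist : dist (h, s) ((0 : ℝ), a) < δ := by
    rw [Prod.dist_eq, max_lt_iff, dist_zero_right, Real.norm_eq_abs, Real.dist_eq]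
    refine ⟨hh, lt_of_le_of_lt ?_ hh⟩
    simpa using abs_sub_left_of_mem_uIcc (uIoc_subset_uIcc hs)
  exact (dist_eq_norm (k h s) (k 0 a)).symm.trans_le (hkδ hdist).le

theorem IsContractionSemigroup.hasDerivAt_duhamel (hT : IsContractionSemigroup T)
    (hF : ∀ t, HasDerivAt F (F' t) t) (hF' : Continuous F') (t : ℝ) :
    HasDerivAt (duhamel T F) (T t (F 0) + duhamel T F' t) t := by
  have hFc : Continuous F := continuous_iff_continuousAt.2 fun t => (hF t).continuousAt
  have hk : Continuous (Function.uncurry fun h s => T s (F (t + h - s))) :=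
    (hT.continuous_apply_comp_sub hFc).comp
      ((continuous_fst.const_add t).prodMk continuous_snd)
  have hshift : HasDerivAt (fun h => duhamel T F (t + h)) (T t (F 0) + duhamel T F' t) (t - t) := by
    rw [sub_self]
    refine (((hT.hasDerivAt_integral_apply_add_sub hF hF' t).add
      (hasDerivAt_integral_add_zero hk t)).congr_deriv (by simp [add_comm])).congr_of_eventuallyEq
      (Eventually.of_forall fun h => ?_)
    exact (intervalIntegral.integral_add_adjacent_intervals
      (hT.intervalIntegrable_apply_sub hFc _ _ _)
      (hT.intervalIntegrable_apply_sub hFc _ _ _)).symm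
  simpa using hshift.comp_sub_const t t

theorem IsContractionSemigroup.apply_duhamel (hT : IsContractionSemigroup T) (hF : Continuous F)
    {t h : ℝ} (ht : 0 ≤ t) (hh : 0 ≤ h) :
    T h (duhamel T F t) = duhamel T F (t + h) - ∫ s in (0 : ℝ)..h, T s (F (t + h - s)) := by
  have hadj := intervalIntegral.integral_add_adjacent_intervals (a := 0) (b := h) (c := t + h)
    (hT.intervalIntegrable_apply_sub hF (t + h) _ _) (hT.intervalIntegrable_apply_sub hF _ _ _)
  rw [duhamel, duhamel, ← hadj, add_sub_cancel_left,
    ← ContinuousLinearMap.intervalIntegral_comp_comm _ (hT.intervalIntegrable_apply_sub hF _ _ _)]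
  have hsubst := intervalIntegral.integral_comp_add_right (a := 0) (b := t)
    (fun s => T s (F (t + h - s))) h
  rw [zero_add] at hsubst
  rw [← hsubst]
  refine intervalIntegral.integral_congr fun s hs => ?_
  rw [uIcc_of_le ht] at hs
  simp only [add_sub_add_right_eq_sub]
  rw [add_comm s h, hT.map_add h s hh hs.1, ContinuousLinearMap.comp_apply]

theorem IsGeneratorOf.duhamel_mem_graph (hA : IsGeneratorOf A T) (hT : IsContractionSemigroup T)
    (hF : Continuous F) {t : ℝ} (ht : 0 ≤ t) {w' : X} (hw : HasDerivAt (duhamel T F) w' t) :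
    (duhamel T F t, w' - F t) ∈ A.graph := by
  rw [hA]
  have hk : Continuous (Function.uncurry fun h s => T s (F (t + h - s))) :=
    (hT.continuous_apply_comp_sub hF).comp
      ((continuous_fst.const_add t).prodMk continuous_snd)
  have hlim := hw.tendsto_slope_zero_right.sub
    (hasDerivAt_integral_add_zero hk 0).tendsto_slope_zero_right
  simp only [add_zero, sub_zero, hT.map_zero, ContinuousLinearMap.id_apply, zero_add,
    intervalIntegral.integral_same] at hlim
  refine hlim.congr' ?_
  filter_upwards [self_mem_nhdsWithin] with h (hh : 0 < h)
  rw [hT.apply_duhamel hF ht hh.le, ← Complex.coe_smul h⁻¹, ← Complex.coe_smul h⁻¹, ← smul_sub,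
    Complex.ofReal_inv]
  congr 1
  abel

theorem IsGeneratorOf.exists_solution (hA : IsGeneratorOf A T) (hT : IsContractionSemigroup T)
    (hF : ∀ t, HasDerivAt F (F' t) t) (hF' : Continuous F') (v₀ : A.domain) :
    ∃ v v' : ℝ → X, v 0 = v₀ ∧ Continuous v' ∧ ∀ t, 0 ≤ t →
      HasDerivWithinAt v (v' t) (Ici 0) t ∧ (v t, v' t - F t) ∈ A.graph := by
  have hFc : Continuous F := continuous_iff_continuousAt.2 fun t => (hF t).continuousAt
  have hv₀ : ((v₀ : X), A v₀) ∈ A.graph := A.mem_graph v₀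
  refine ⟨fun t => T t v₀ + duhamel T F t,
    fun t => T t (A v₀) + (T t (F 0) + duhamel T F' t), ?_, ?_, fun t ht => ⟨?_, ?_⟩⟩
  · simp [hT.map_zero, duhamel]
  · exact (hT.continuous_apply _).add ((hT.continuous_apply _).add (hT.continuous_duhamel hF'))
  · exact (hA.hasDerivWithinAt hT hv₀ ht).add (hT.hasDerivAt_duhamel hF hF' t).hasDerivWithinAt
  · have hsum := A.graph.add_mem (hA.map_mem_graph hT.toIsC0Semigroup hv₀ ht)
      (hA.duhamel_mem_graph hT hFc ht (hT.hasDerivAt_duhamel hF hF' t))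
    rwa [Prod.mk_add_mk, ← add_sub_assoc] at hsum

end Duhamel

section AbsoluteContinuity

open scoped InnerProductSpace

theorem absolutelyContinuousOnInterval_of_dist_le {E F : Type*} [PseudoMetricSpace E]
    [PseudoMetricSpace F] {f : ℝ → E} {g : ℝ → F} {a b : ℝ}
    (hf : AbsolutelyContinuousOnInterval f a b)
    (h : ∀ x ∈ uIcc a b, ∀ y ∈ uIcc a b, dist (g x) (g y) ≤ dist (f x) (f y)) :
    AbsolutelyContinuousOnInterval g a b := by
  refine squeeze_zero' (Eventually.of_forall fun _ => Finset.sum_nonneg fun _ _ => dist_nonneg)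
    ?_ hf
  filter_upwards [mem_inf_of_right (mem_principal_self _)] with I hI
  exact Finset.sum_le_sum fun i hi => h _ (hI.1 i hi).1 _ (hI.1 i hi).2

theorem absolutelyContinuousOnInterval_norm_sq {E : Type*} [SeminormedAddCommGroup E]
    {f : ℝ → E} {a b : ℝ} (hf : AbsolutelyContinuousOnInterval f a b) :
    AbsolutelyContinuousOnInterval (fun x => ‖f x‖ ^ 2) a b := by
  have hnorm : AbsolutelyContinuousOnInterval (fun x => ‖f x‖) a b :=
    absolutelyContinuousOnInterval_of_dist_le hf fun x _ y _ =>
      (dist_norm_norm_le (f x) (f y)).trans_eq (dist_eq_norm _ _).symm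
  simpa only [pow_two] using hnorm.fun_mul hnorm

theorem absolutelyContinuousOnInterval_integral {E : Type*} [NormedAddCommGroup E]
    [NormedSpace ℝ E] {f : ℝ → E} {a b c : ℝ} (hf : IntervalIntegrable f volume a b)
    (hc : c ∈ uIcc a b) :
    AbsolutelyContinuousOnInterval (fun x => ∫ v in c..x, f v) a b := by
  refine absolutelyContinuousOnInterval_of_dist_le
    (hf.norm.absolutelyContinuousOnInterval_intervalIntegral hc) fun x hx y hy => ?_
  have hfc (z : ℝ) (hz : z ∈ uIcc a b) : IntervalIntegrable f volume c z :=
    hf.mono_set (uIcc_subset_uIcc hc hz)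
  rw [dist_eq_norm, dist_eq_norm, Real.norm_eq_abs,
    intervalIntegral.integral_interval_sub_left (hfc x hx) (hfc y hy),
    intervalIntegral.integral_interval_sub_left (hfc x hx).norm (hfc y hy).norm]
  exact intervalIntegral.norm_integral_le_abs_integral_norm

theorem LocallyAbsolutelyContinuous.integral {f : ℝ → ℂ}
    (hf : ∀ b, IntervalIntegrable f volume 0 b) :
    LocallyAbsolutelyContinuous fun x => ∫ v in (0 : ℝ)..x, f v := fun _ b ha hab =>
  (absolutelyContinuousOnInterval_integral (hf b) left_mem_uIcc).mono <|
    uIcc_subset_uIcc (mem_uIcc.2 (Or.inl ⟨ha, hab⟩)) right_mem_uIcc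

theorem LocallyAbsolutelyContinuous.const_sub {f : ℝ → ℂ} (hf : LocallyAbsolutelyContinuous f)
    (C : ℂ) : LocallyAbsolutelyContinuous fun x => C - f x := fun _ _ ha hab =>
  absolutelyContinuousOnInterval_of_dist_le (hf _ _ ha hab) fun x _ y _ =>
    (dist_sub_left C (f x) (f y)).le

theorem LocallyAbsolutelyContinuous.integral_inner {f z : ℝ → ℂ}
    (hf : LocallyAbsolutelyContinuous f)
    (hz : ∀ᵐ ξ ∂(volume.restrict (Ici (0 : ℝ))), HasDerivAt f (z ξ) ξ) {N : ℝ} (hN : 0 ≤ N) :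
    IntervalIntegrable (fun ξ => 2 * ⟪f ξ, z ξ⟫_ℝ) volume 0 N ∧
    ∫ ξ in (0 : ℝ)..N, 2 * ⟪f ξ, z ξ⟫_ℝ = ‖f N‖ ^ 2 - ‖f 0‖ ^ 2 := by
  have hac := absolutelyContinuousOnInterval_norm_sq (hf 0 N le_rfl hN)
  have hderiv : ∀ᵐ ξ, ξ ∈ uIoc 0 N → deriv (fun ξ => ‖f ξ‖ ^ 2) ξ = 2 * ⟪f ξ, z ξ⟫_ℝ := by
    rw [ae_restrict_iff' measurableSet_Ici] at hz
    filter_upwards [hz] with ξ h hξ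
    rw [uIoc_of_le hN] at hξ
    exact (h hξ.1.le).norm_sq.deriv
  rw [← hac.integral_deriv_eq_sub]
  refine ⟨hac.intervalIntegrable_deriv.congr_ae ?_, intervalIntegral.integral_congr_ae ?_⟩
  · rwa [← ae_restrict_iff' measurableSet_uIoc] at hderiv
  · filter_upwards [hderiv] with ξ h hξ
    exact (h hξ).symm

theorem LocallyAbsolutelyContinuous.tendsto_norm_sq {f z : ℝ → ℂ}
    (hf : LocallyAbsolutelyContinuous f)
    (hz : ∀ᵐ ξ ∂(volume.restrict (Ici (0 : ℝ))), HasDerivAt f (z ξ) ξ)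
    (hint : IntegrableOn (fun ξ => ⟪f ξ, z ξ⟫_ℝ) (Ici 0)) :
    Tendsto (fun N => ‖f N‖ ^ 2) atTop
      (𝓝 ((∫ ξ in Ici (0 : ℝ), 2 * ⟪f ξ, z ξ⟫_ℝ) + ‖f 0‖ ^ 2)) := by
  rw [integral_Ici_eq_integral_Ioi]
  refine ((intervalIntegral_tendsto_integral_Ioi 0 ((hint.mono_set Ioi_subset_Ici_self).const_mul 2)
    tendsto_id).add_const (‖f 0‖ ^ 2)).congr' ?_
  filter_upwards [eventually_ge_atTop 0] with N hN
  rw [id, (hf.integral_inner hz hN).2, sub_add_cancel]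

theorem eq_zero_of_tendsto_of_integrableOn_mul {w g : ℝ → ℝ} {a L : ℝ}
    (hw : ContinuousOn w (Ici a)) (hw0 : ∀ ξ, a ≤ ξ → 0 ≤ w ξ) (hwint : ¬ IntegrableOn w (Ici a))
    (hg0 : ∀ ξ, 0 ≤ g ξ) (hint : IntegrableOn (fun ξ => w ξ * g ξ) (Ici a))
    (hlim : Tendsto g atTop (𝓝 L)) : L = 0 := by
  by_contra hL
  have hLpos : 0 < L := lt_of_le_of_ne (ge_of_tendsto' hlim hg0) (Ne.symm hL)
  obtain ⟨b, hb⟩ := eventually_atTop.1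
    ((hlim.eventually (eventually_ge_nhds (half_lt_self hLpos))).and (eventually_ge_atTop a))
  have hab : a ≤ b := (hb b le_rfl).2
  refine hwint ?_
  rw [← Icc_union_Ici_eq_Ici hab]
  refine ((hw.mono Icc_subset_Ici_self).integrableOn_Icc).union ?_
  refine ((hint.mono_set (Ici_subset_Ici.2 hab)).const_mul (L / 2)⁻¹).mono'
    ((hw.mono (Ici_subset_Ici.2 hab)).aestronglyMeasurable measurableSet_Ici) ?_
  filter_upwards [ae_restrict_mem measurableSet_Ici] with ξ hξ
  have hwξ := hw0 ξ (hab.trans hξ)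
  rw [Real.norm_of_nonneg hwξ, inv_mul_eq_div, le_div_iff₀ (half_pos hLpos)]
  exact mul_le_mul_of_nonneg_left (hb ξ hξ).1 hwξ

theorem LocallyAbsolutelyContinuous.integrableOn_of_le_inner {f z : ℝ → ℂ} {q g : ℝ → ℝ}
    {κ K : ℝ} (hf : LocallyAbsolutelyContinuous f)
    (hz : ∀ᵐ ξ ∂(volume.restrict (Ici (0 : ℝ))), HasDerivAt f (z ξ) ξ)
    (hq : ContinuousOn q (Ici 0)) (hq0 : ∀ ξ, 0 ≤ ξ → 0 ≤ q ξ)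
    (hg : IntegrableOn g (Ici 0)) (hg0 : ∀ ξ, 0 ≤ ξ → 0 ≤ g ξ)
    (hqg : ∀ ξ, 0 ≤ ξ → q ξ ≤ κ * (2 * ⟪f ξ, z ξ⟫_ℝ) + g ξ)
    (hK : ∀ N, 0 ≤ N → κ * (‖f N‖ ^ 2 - ‖f 0‖ ^ 2) ≤ K) :
    IntegrableOn q (Ici 0) := by
  rw [integrableOn_Ici_iff_integrableOn_Ioi]
  have hqint (N : ℝ) (hN : 0 ≤ N) : IntervalIntegrable q volume 0 N :=
    (hq.mono (by rw [uIcc_of_le hN]; exact Icc_subset_Ici_self)).intervalIntegrable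
  have hgint (N : ℝ) (hN : 0 ≤ N) : IntervalIntegrable g volume 0 N := by
    rw [intervalIntegrable_iff_integrableOn_Ioc_of_le hN]
    exact hg.mono_set (Ioc_subset_Ioi_self.trans Ioi_subset_Ici_self)
  refine integrableOn_Ioi_of_intervalIntegral_norm_bounded (K + ∫ ξ in Ici 0, g ξ) 0
    (fun N : ℝ => ((hq.mono Icc_subset_Ici_self).integrableOn_Icc (a := 0) (b := N)).mono_set
      Ioc_subset_Icc_self) tendsto_id ?_
  filter_upwards [eventually_ge_atTop 0] with N hN
  obtain ⟨hint, hftc⟩ := hf.integral_inner hz hN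
  calc ∫ ξ in (0 : ℝ)..N, ‖q ξ‖
      = ∫ ξ in (0 : ℝ)..N, q ξ := intervalIntegral.integral_congr fun ξ hξ =>
        Real.norm_of_nonneg (hq0 ξ (by rw [uIcc_of_le hN] at hξ; exact hξ.1))
    _ ≤ ∫ ξ in (0 : ℝ)..N, (κ * (2 * ⟪f ξ, z ξ⟫_ℝ) + g ξ) :=
        intervalIntegral.integral_mono_on hN (hqint N hN)
          ((hint.const_mul κ).add (hgint N hN)) fun ξ hξ => hqg ξ hξ.1
    _ = κ * (‖f N‖ ^ 2 - ‖f 0‖ ^ 2) + ∫ ξ in (0 : ℝ)..N, g ξ := by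
        rw [intervalIntegral.integral_add (hint.const_mul κ) (hgint N hN),
          intervalIntegral.integral_const_mul, hftc]
    _ ≤ K + ∫ ξ in Ici 0, g ξ := by
        refine add_le_add (hK N hN) ?_
        rw [intervalIntegral.integral_of_le hN]
        refine setIntegral_mono_set hg ?_
          (Eventually.of_forall (Ioc_subset_Ioi_self.trans Ioi_subset_Ici_self))
        filter_upwards [ae_restrict_mem measurableSet_Ici] with ξ hξ using hg0 ξ hξ

end AbsoluteContinuity

section WeightedSpace

open scoped InnerProductSpace

variable {δ : ℝ → ℝ}

theorem aemeasurable_weight (hδ : ContinuousOn δ (Ici 0)) :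
    AEMeasurable (fun ξ => ENNReal.ofReal |δ ξ|) (volume.restrict (Ici 0)) :=
  (hδ.abs.aemeasurable measurableSet_Ici).ennreal_ofReal

theorem integrable_weightedMeasure_iff {E : Type*} [NormedAddCommGroup E] [NormedSpace ℝ E]
    (hδ : ContinuousOn δ (Ici 0)) {g : ℝ → E} :
    Integrable g (weightedMeasure δ) ↔ IntegrableOn (fun ξ => |δ ξ| • g ξ) (Ici 0) := by
  rw [weightedMeasure, integrable_withDensity_iff_integrable_smul₀' (aemeasurable_weight hδ)
    (Eventually.of_forall fun _ => ENNReal.ofReal_lt_top)]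
  simp only [ENNReal.toReal_ofReal (abs_nonneg _), IntegrableOn]

theorem integral_weightedMeasure {E : Type*} [NormedAddCommGroup E] [NormedSpace ℝ E]
    (hδ : ContinuousOn δ (Ici 0)) (g : ℝ → E) :
    ∫ ξ, g ξ ∂(weightedMeasure δ) = ∫ ξ in Ici 0, |δ ξ| • g ξ := by
  rw [weightedMeasure, integral_withDensity_eq_integral_toReal_smul₀ (aemeasurable_weight hδ)
    (Eventually.of_forall fun _ => ENNReal.ofReal_lt_top)]
  simp only [ENNReal.toReal_ofReal (abs_nonneg _)]

theorem memLp_two_weightedMeasure_iff {E : Type*} [NormedAddCommGroup E]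
    (hδ : ContinuousOn δ (Ici 0)) {g : ℝ → E}
    (hg : AEStronglyMeasurable g (volume.restrict (Ici 0))) :
    MemLp g 2 (weightedMeasure δ) ↔ IntegrableOn (fun ξ => |δ ξ| * ‖g ξ‖ ^ 2) (Ici 0) := by
  have hg' : AEStronglyMeasurable g (weightedMeasure δ) :=
    hg.mono_ac (withDensity_absolutelyContinuous _ _)
  rw [memLp_two_iff_integrable_sq_norm hg', integrable_weightedMeasure_iff hδ]
  simp only [smul_eq_mul]

theorem integrableOn_abs_mul_norm_sq (hδ : ContinuousOn δ (Ici 0))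
    (x : Lp ℂ 2 (weightedMeasure δ)) : IntegrableOn (fun ξ => |δ ξ| * ‖x ξ‖ ^ 2) (Ici 0) :=
  (integrable_weightedMeasure_iff hδ).1
    ((memLp_two_iff_integrable_sq_norm (Lp.memLp x).1).1 (Lp.memLp x))

/-- `δ` is a continuous, nowhere vanishing transport speed on `[0, ∞)` of constant sign `σ = ±1`:
in `ẋ = (δ x)'` the information leaves the half-line through `0` if `σ = 1` and enters there if
`σ = -1`. -/
structure IsTransportSpeed (δ : ℝ → ℝ) (σ : ℝ) : Prop where
  continuousOn : ContinuousOn δ (Ici 0)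
  sign_mul_sign : σ * σ = 1
  sign_mul_pos : ∀ ξ, 0 ≤ ξ → 0 < σ * δ ξ

/-- The slowness `1 / |δ|` of the transport speed `δ` on `[0, ∞)`, extended to `ℝ` as a constant
on the left so that it stays continuous and positive. -/
noncomputable def slowness (δ : ℝ → ℝ) (ξ : ℝ) : ℝ := |δ (max ξ 0)|⁻¹

namespace IsTransportSpeed

variable {σ : ℝ}

theorem ne_zero (h : IsTransportSpeed δ σ) {ξ : ℝ} (hξ : 0 ≤ ξ) : δ ξ ≠ 0 :=
  right_ne_zero_of_mul (h.sign_mul_pos ξ hξ).ne'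

theorem abs_sign (h : IsTransportSpeed δ σ) : |σ| = 1 :=
  (abs_eq zero_le_one).2 (mul_self_eq_one_iff.1 h.sign_mul_sign)

theorem abs_eq (h : IsTransportSpeed δ σ) {ξ : ℝ} (hξ : 0 ≤ ξ) : |δ ξ| = σ * δ ξ := by
  rw [← abs_of_pos (h.sign_mul_pos ξ hξ), abs_mul, h.abs_sign, one_mul]

theorem continuous_slowness (h : IsTransportSpeed δ σ) : Continuous (slowness δ) :=
  (h.continuousOn.comp_continuous (continuous_id.max continuous_const)
    fun _ => mem_Ici.2 (le_max_right _ _)).abs.inv₀ fun _ =>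
      abs_ne_zero.2 (h.ne_zero (le_max_right _ _))

theorem slowness_pos (h : IsTransportSpeed δ σ) (ξ : ℝ) : 0 < slowness δ ξ :=
  inv_pos.2 (abs_pos.2 (h.ne_zero (le_max_right _ _)))

theorem mul_slowness (h : IsTransportSpeed δ σ) {ξ : ℝ} (hξ : 0 ≤ ξ) :
    δ ξ * slowness δ ξ = σ := by
  rw [slowness, max_eq_left hξ, ← div_eq_mul_inv, div_eq_iff (abs_ne_zero.2 (h.ne_zero hξ)),
    h.abs_eq hξ, ← mul_assoc, h.sign_mul_sign, one_mul]

end IsTransportSpeed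

theorem slowness_mul_norm_sq {ξ : ℝ} (hξ : 0 ≤ ξ) (x : ℂ) :
    slowness δ ξ * ‖(δ ξ : ℂ) * x‖ ^ 2 = |δ ξ| * ‖x‖ ^ 2 := by
  rw [slowness, max_eq_left hξ, norm_mul, Complex.norm_real, Real.norm_eq_abs, mul_pow,
    pow_two |_|]
  rcases eq_or_ne |δ ξ| 0 with h0 | h0
  · rw [h0, zero_mul, zero_mul, mul_zero]
  · rw [← mul_assoc, inv_mul_cancel_left₀ h0]

theorem integrableOn_slowness_iff :
    IntegrableOn (slowness δ) (Ici 0) ↔ IntegrableOn (fun ξ => |δ ξ|⁻¹) (Ici 0) :=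
  integrableOn_congr_fun (fun ξ hξ => by rw [slowness, max_eq_left (mem_Ici.1 hξ)])
    measurableSet_Ici

theorem not_integrableOn_abs_inv {M : ℝ} (hne : ∀ ξ, 0 ≤ ξ → δ ξ ≠ 0)
    (hM : ∀ ξ, 0 ≤ ξ → |δ ξ| ≤ M) : ¬ IntegrableOn (fun ξ => |δ ξ|⁻¹) (Ici 0) := by
  intro hint
  have hMpos : 0 < M := (abs_pos.2 (hne 0 le_rfl)).trans_le (hM 0 le_rfl)
  have hconst : IntegrableOn (fun _ : ℝ => M⁻¹) (Ici 0) := by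
    refine Integrable.mono' hint aestronglyMeasurable_const ?_
    filter_upwards [ae_restrict_mem measurableSet_Ici] with ξ hξ
    rw [Real.norm_of_nonneg (inv_nonneg.2 hMpos.le)]
    exact inv_anti₀ (abs_pos.2 (hne ξ hξ)) (hM ξ hξ)
  rw [integrableOn_const_iff, Real.volume_Ici] at hconst
  exact hconst.elim (enorm_ne_zero.2 (inv_ne_zero hMpos.ne')) (lt_irrefl _)

/-- `f` is the locally absolutely continuous representative of `δ x`, and `z = (δ x)'`: the scalar
counterpart of `SignedDiagonal.IsRepresentative`. -/
structure IsWeightedRep (δ : ℝ → ℝ) (x : Lp ℂ 2 (weightedMeasure δ)) (f : ℝ → ℂ)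
    (z : Lp ℂ 2 (weightedMeasure δ)) : Prop where
  absCont : LocallyAbsolutelyContinuous f
  eq_mul : ∀ᵐ ξ ∂(volume.restrict (Ici (0 : ℝ))), f ξ = (δ ξ : ℂ) * x ξ
  hasDerivAt : ∀ᵐ ξ ∂(volume.restrict (Ici (0 : ℝ))), HasDerivAt f (z ξ) ξ

theorem ae_slowness_mul_norm_sq {f x : ℝ → ℂ}
    (h : ∀ᵐ ξ ∂(volume.restrict (Ici (0 : ℝ))), f ξ = (δ ξ : ℂ) * x ξ) :
    (fun ξ => slowness δ ξ * ‖f ξ‖ ^ 2) =ᵐ[volume.restrict (Ici (0 : ℝ))]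
      fun ξ => |δ ξ| * ‖x ξ‖ ^ 2 := by
  filter_upwards [h, ae_restrict_mem measurableSet_Ici] with ξ h1 hξ
  rw [h1, slowness_mul_norm_sq hξ]

namespace IsTransportSpeed

variable {σ : ℝ}

theorem ae_of_ae (hδ : IsTransportSpeed δ σ) {q : ℝ → Prop} (h : ∀ᵐ ξ ∂(weightedMeasure δ), q ξ) :
    ∀ᵐ ξ ∂(volume.restrict (Ici (0 : ℝ))), q ξ := by
  rwa [ae_weightedMeasure hδ.continuousOn fun _ => hδ.ne_zero] at h

theorem integrableOn_slowness_mul_norm_sq (hδ : IsTransportSpeed δ σ) {f : ℝ → ℂ}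
    {x : Lp ℂ 2 (weightedMeasure δ)}
    (h : ∀ᵐ ξ ∂(volume.restrict (Ici (0 : ℝ))), f ξ = (δ ξ : ℂ) * x ξ) :
    IntegrableOn (fun ξ => slowness δ ξ * ‖f ξ‖ ^ 2) (Ici 0) :=
  (integrableOn_abs_mul_norm_sq hδ.continuousOn x).congr (ae_slowness_mul_norm_sq h).symm

theorem exists_lp_eq_mul (hδ : IsTransportSpeed δ σ) {f : ℝ → ℂ}
    (hf : AEStronglyMeasurable f (volume.restrict (Ici 0)))
    (hint : IntegrableOn (fun ξ => slowness δ ξ * ‖f ξ‖ ^ 2) (Ici 0)) :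
    ∃ x : Lp ℂ 2 (weightedMeasure δ),
      ∀ᵐ ξ ∂(volume.restrict (Ici (0 : ℝ))), f ξ = (δ ξ : ℂ) * x ξ := by
  have hmul : ∀ᵐ ξ ∂(volume.restrict (Ici (0 : ℝ))), f ξ = (δ ξ : ℂ) * ((δ ξ : ℂ)⁻¹ * f ξ) := by
    filter_upwards [ae_restrict_mem measurableSet_Ici] with ξ hξ
    rw [mul_inv_cancel_left₀ (Complex.ofReal_ne_zero.2 (hδ.ne_zero hξ))]
  have hδmeas : AEStronglyMeasurable (fun ξ => (δ ξ : ℂ)⁻¹) (volume.restrict (Ici 0)) :=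
    ((Complex.continuous_ofReal.comp_continuousOn hδ.continuousOn).inv₀ fun _ hξ =>
      Complex.ofReal_ne_zero.2 (hδ.ne_zero hξ)).aestronglyMeasurable measurableSet_Ici
  have hmem : MemLp (fun ξ => (δ ξ : ℂ)⁻¹ * f ξ) 2 (weightedMeasure δ) :=
    (memLp_two_weightedMeasure_iff hδ.continuousOn (hδmeas.mul hf)).2
      (hint.congr (ae_slowness_mul_norm_sq hmul))
  refine ⟨hmem.toLp _, ?_⟩
  filter_upwards [hmul, hδ.ae_of_ae hmem.coeFn_toLp] with ξ h1 h2
  rw [h2, ← h1]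

end IsTransportSpeed

namespace IsWeightedRep

variable {σ : ℝ} {x z : Lp ℂ 2 (weightedMeasure δ)} {f : ℝ → ℂ}

theorem smul (hδ : IsTransportSpeed δ σ) (h : IsWeightedRep δ x f z) (c : ℂ) :
    IsWeightedRep δ (c • x) (c • f) (c • z) where
  absCont a b ha hab := (h.absCont a b ha hab).const_smul c
  eq_mul := by
    filter_upwards [h.eq_mul, hδ.ae_of_ae (Lp.coeFn_smul c x)] with ξ h1 h2
    rw [h2, Pi.smul_apply, Pi.smul_apply, h1, mul_smul_comm]
  hasDerivAt := by
    filter_upwards [h.hasDerivAt, hδ.ae_of_ae (Lp.coeFn_smul c z)] with ξ h1 h2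
    rw [h2]
    exact h1.const_smul c

/-- The boundary term at infinity vanishes because the travel time to infinity is infinite, so that
`‖f‖²` cannot have a nonzero limit. -/
theorem two_mul_re_inner (hδ : IsTransportSpeed δ σ)
    (htravel : ¬ IntegrableOn (fun ξ => |δ ξ|⁻¹) (Ici 0))
    (h : IsWeightedRep δ x f z) : 2 * (⟪x, z⟫_ℂ).re = -(σ * ‖f 0‖ ^ 2) := by
  have hinner : IntegrableOn (fun ξ => |δ ξ| • ⟪x ξ, z ξ⟫_ℂ) (Ici 0) :=
    (integrable_weightedMeasure_iff hδ.continuousOn).1 (L2.integrable_inner x z)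
  have hpointwise : ∀ᵐ ξ ∂(volume.restrict (Ici (0 : ℝ))),
      (|δ ξ| • ⟪x ξ, z ξ⟫_ℂ).re = σ * ⟪f ξ, z ξ⟫_ℝ := by
    filter_upwards [h.eq_mul, ae_restrict_mem measurableSet_Ici] with ξ h1 hξ
    rw [h1, ← Complex.real_smul, real_inner_smul_left, ← mul_assoc, ← hδ.abs_eq hξ,
      Complex.smul_re, smul_eq_mul]
    rfl
  have hint : IntegrableOn (fun ξ => ⟪f ξ, z ξ⟫_ℝ) (Ici 0) := by
    refine (hinner.re.const_mul σ).congr ?_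
    filter_upwards [hpointwise] with ξ h1
    rw [RCLike.re_to_complex, h1, ← mul_assoc, hδ.sign_mul_sign, one_mul]
  have hlim := eq_zero_of_tendsto_of_integrableOn_mul hδ.continuous_slowness.continuousOn
    (fun ξ _ => (hδ.slowness_pos ξ).le) (integrableOn_slowness_iff.not.2 htravel)
    (fun ξ => sq_nonneg ‖f ξ‖)
    (hδ.integrableOn_slowness_mul_norm_sq h.eq_mul) (h.absCont.tendsto_norm_sq h.hasDerivAt hint)
  rw [integral_const_mul] at hlim
  calc 2 * (⟪x, z⟫_ℂ).re = 2 * ∫ ξ in Ici 0, (|δ ξ| • ⟪x ξ, z ξ⟫_ℂ).re := by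
        rw [L2.inner_def, integral_weightedMeasure hδ.continuousOn]
        exact congrArg (2 * ·) (integral_re hinner).symm
    _ = σ * (2 * ∫ ξ in Ici (0 : ℝ), ⟪f ξ, z ξ⟫_ℝ) := by
        rw [integral_congr_ae hpointwise, integral_const_mul, mul_left_comm]
    _ = -(σ * ‖f 0‖ ^ 2) := by
        rw [eq_neg_of_add_eq_zero_left hlim, mul_neg]

end IsWeightedRep

end WeightedSpace

section TransportEquation

open scoped InnerProductSpace

/-- The time `∫₀^ξ w` that a wave with slowness `w` needs to travel from `0` to `ξ`. -/
noncomputable def travelTime (w : ℝ → ℝ) (ξ : ℝ) : ℝ := ∫ η in (0 : ℝ)..ξ, w η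

/-- `Y` is square integrable with respect to the density `1 / w`, and the integrable function `W`
dominates `‖Y‖² / w`; the inequality is stated without the quotient because `w` may vanish. -/
structure IsForcing (w : ℝ → ℝ) (Y : ℝ → ℂ) (W : ℝ → ℝ) : Prop where
  aestronglyMeasurable : AEStronglyMeasurable Y
  integrable : Integrable W
  nonneg : ∀ ξ, 0 ≤ W ξ
  norm_sq_le : ∀ ξ, ‖Y ξ‖ ^ 2 ≤ w ξ * W ξ

/-- The integrand of the variation of constants formula for `f' = c w f - Y`. -/
noncomputable def dampedForcing (w : ℝ → ℝ) (Y : ℝ → ℂ) (c : ℂ) (ξ : ℝ) : ℂ :=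
  Complex.exp (-c * travelTime w ξ) * Y ξ

/-- The solution of `f' = c w f - Y` with `f 0 = C`. -/
noncomputable def variationOfConstants (w : ℝ → ℝ) (Y : ℝ → ℂ) (c C : ℂ) (ξ : ℝ) : ℂ :=
  Complex.exp (c * travelTime w ξ) * (C - ∫ η in (0 : ℝ)..ξ, dampedForcing w Y c η)

theorem travelTime_zero (w : ℝ → ℝ) : travelTime w 0 = 0 := intervalIntegral.integral_same

theorem norm_exp_mul_ofReal (c : ℂ) (t : ℝ) : ‖Complex.exp (c * t)‖ = Real.exp (c.re * t) := by
  rw [Complex.norm_exp, Complex.re_mul_ofReal]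

variable {w : ℝ → ℝ}

theorem hasDerivAt_travelTime (hw : Continuous w) (ξ : ℝ) : HasDerivAt (travelTime w) (w ξ) ξ :=
  (hw.integral_hasStrictDerivAt 0 ξ).hasDerivAt

theorem continuous_travelTime (hw : Continuous w) : Continuous (travelTime w) :=
  continuous_iff_continuousAt.2 fun ξ => (hasDerivAt_travelTime hw ξ).continuousAt

theorem hasDerivAt_exp_travelTime (hw : Continuous w) (c : ℂ) (ξ : ℝ) :
    HasDerivAt (fun ξ => Complex.exp (c * travelTime w ξ))
      (Complex.exp (c * travelTime w ξ) * (c * w ξ)) ξ :=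
  ((hasDerivAt_travelTime hw ξ).ofReal_comp.const_mul c).cexp

theorem continuous_exp_travelTime (hw : Continuous w) (c : ℂ) :
    Continuous fun ξ => Complex.exp (c * travelTime w ξ) :=
  continuous_iff_continuousAt.2 fun ξ => (hasDerivAt_exp_travelTime hw c ξ).continuousAt

theorem locallyAbsolutelyContinuous_exp_travelTime (hw : Continuous w) (c : ℂ) :
    LocallyAbsolutelyContinuous fun ξ => Complex.exp (c * travelTime w ξ) := by
  have hd := hasDerivAt_exp_travelTime hw c
  have hC1 : ContDiff ℝ 1 fun ξ => Complex.exp (c * travelTime w ξ) := by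
    refine contDiff_one_iff_deriv.2 ⟨fun ξ => (hd ξ).differentiableAt, ?_⟩
    rw [funext fun ξ => (hd ξ).deriv]
    exact (continuous_exp_travelTime hw c).mul
      (continuous_const.mul (Complex.continuous_ofReal.comp hw))
  exact fun _ _ _ _ => hC1.contDiffOn.absolutelyContinuousOnInterval

theorem continuous_mul_exp_travelTime (hw : Continuous w) (κ ξ : ℝ) :
    Continuous fun η => w η * Real.exp (-κ * (travelTime w η - travelTime w ξ)) := by
  have hφ := continuous_travelTime hw
  fun_prop

theorem integral_mul_exp_travelTime_le (hw : Continuous w) {κ : ℝ} (hκ : 0 < κ) (a b : ℝ) :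
    ∫ η in a..b, w η * Real.exp (-κ * (travelTime w η - travelTime w a)) ≤ κ⁻¹ := by
  have hprimitive (η : ℝ) :
      HasDerivAt (fun η => -κ⁻¹ * Real.exp (-κ * (travelTime w η - travelTime w a)))
        (w η * Real.exp (-κ * (travelTime w η - travelTime w a))) η := by
    refine ((((hasDerivAt_travelTime hw η).sub_const _).const_mul (-κ)).exp.const_mul
      (-κ⁻¹)).congr_deriv ?_
    field_simp
  rw [intervalIntegral.integral_eq_sub_of_hasDerivAt (fun η _ => hprimitive η)
    ((continuous_mul_exp_travelTime hw κ a).intervalIntegrable _ _),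
    sub_self, mul_zero, Real.exp_zero, mul_one, neg_mul, sub_neg_eq_add, neg_add_le_iff_le_add]
  exact le_add_of_nonneg_left (by positivity)

theorem integrableOn_mul_exp_travelTime (hw : Continuous w) (hw0 : ∀ ξ, 0 ≤ w ξ) {κ : ℝ}
    (hκ : 0 < κ) :
    IntegrableOn (fun η => w η * Real.exp (-κ * travelTime w η)) (Ioi 0) := by
  have hcont := continuous_mul_exp_travelTime hw κ 0
  have hbound := integral_mul_exp_travelTime_le hw hκ 0
  simp only [travelTime_zero, sub_zero] at hcont hbound
  refine integrableOn_Ioi_of_intervalIntegral_norm_bounded κ⁻¹ 0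
    (fun b : ℝ => hcont.integrableOn_Ioc) tendsto_id (Eventually.of_forall fun b => ?_)
  refine (intervalIntegral.integral_congr fun η _ => ?_).trans_le (hbound b)
  exact Real.norm_of_nonneg (mul_nonneg (hw0 η) (Real.exp_pos _).le)

namespace IsForcing

variable {Y : ℝ → ℂ} {W : ℝ → ℝ}

theorem two_mul_mul_norm_le (hY : IsForcing w Y W) (hw0 : ∀ ξ, 0 ≤ w ξ) (a ξ : ℝ) :
    2 * (a * ‖Y ξ‖) ≤ w ξ * a ^ 2 + W ξ := by
  have hsum : 0 ≤ w ξ * a ^ 2 + W ξ :=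
    add_nonneg (mul_nonneg (hw0 ξ) (sq_nonneg a)) (hY.nonneg ξ)
  refine (abs_le_of_sq_le_sq' ?_ hsum).2
  calc (2 * (a * ‖Y ξ‖)) ^ 2 = 4 * a ^ 2 * ‖Y ξ‖ ^ 2 := by ring
    _ ≤ 4 * a ^ 2 * (w ξ * W ξ) := by gcongr; exact hY.norm_sq_le ξ
    _ ≤ (w ξ * a ^ 2 + W ξ) ^ 2 := by linarith [sq_nonneg (w ξ * a ^ 2 - W ξ)]

theorem norm_dampedForcing (w : ℝ → ℝ) (Y : ℝ → ℂ) (c : ℂ) (ξ : ℝ) :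
    ‖dampedForcing w Y c ξ‖ = Real.exp (-c.re * travelTime w ξ) * ‖Y ξ‖ := by
  rw [dampedForcing, norm_mul, norm_exp_mul_ofReal, Complex.neg_re]

theorem aestronglyMeasurable_dampedForcing (hY : IsForcing w Y W) (hw : Continuous w) (c : ℂ) :
    AEStronglyMeasurable (dampedForcing w Y c) :=
  (continuous_exp_travelTime hw (-c)).aestronglyMeasurable.mul hY.aestronglyMeasurable

theorem norm_exp_mul_norm_dampedForcing_le (hY : IsForcing w Y W) (hw0 : ∀ ξ, 0 ≤ w ξ) (c : ℂ)
    (ξ η : ℝ) :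
    ‖Complex.exp (c * travelTime w ξ)‖ * ‖dampedForcing w Y c η‖ ≤
      w η * Real.exp (-(2 * c.re) * (travelTime w η - travelTime w ξ)) + W η := by
  have hexp : Real.exp (c.re * travelTime w ξ) * Real.exp (-c.re * travelTime w η) =
      Real.exp (-c.re * (travelTime w η - travelTime w ξ)) := by
    rw [← Real.exp_add]
    ring_nf
  have hsq : Real.exp (-(2 * c.re) * (travelTime w η - travelTime w ξ)) =
      Real.exp (-c.re * (travelTime w η - travelTime w ξ)) ^ 2 := by
    rw [← Real.exp_nat_mul]
    push_cast
    ring_nf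
  rw [norm_exp_mul_ofReal, norm_dampedForcing, ← mul_assoc, hexp, hsq]
  refine (le_mul_of_one_le_left (by positivity) one_le_two).trans ?_
  exact hY.two_mul_mul_norm_le hw0 _ η

theorem norm_dampedForcing_le (hY : IsForcing w Y W) (hw0 : ∀ ξ, 0 ≤ w ξ) (c : ℂ) (η : ℝ) :
    ‖dampedForcing w Y c η‖ ≤ w η * Real.exp (-(2 * c.re) * travelTime w η) + W η := by
  simpa only [travelTime_zero, Complex.ofReal_zero, mul_zero, Complex.exp_zero, norm_one, one_mul,
    sub_zero] using hY.norm_exp_mul_norm_dampedForcing_le hw0 c 0 η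

theorem intervalIntegrable_dampedForcing (hY : IsForcing w Y W) (hw : Continuous w)
    (hw0 : ∀ ξ, 0 ≤ w ξ) (c : ℂ) (a b : ℝ) :
    IntervalIntegrable (dampedForcing w Y c) volume a b := by
  have hφ := continuous_travelTime hw
  have hbound : IntervalIntegrable
      (fun η => w η * Real.exp (-(2 * c.re) * travelTime w η) + W η) volume a b :=
    (Continuous.intervalIntegrable (by fun_prop) _ _).add hY.integrable.intervalIntegrable
  exact hbound.mono_fun' (hY.aestronglyMeasurable_dampedForcing hw c).restrict
    (Eventually.of_forall (hY.norm_dampedForcing_le hw0 c))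

theorem integrableOn_dampedForcing (hY : IsForcing w Y W) (hw : Continuous w)
    (hw0 : ∀ ξ, 0 ≤ w ξ) {c : ℂ} (hc : 0 < c.re) :
    IntegrableOn (dampedForcing w Y c) (Ioi 0) :=
  ((integrableOn_mul_exp_travelTime hw hw0 (mul_pos two_pos hc)).add
    hY.integrable.integrableOn).mono' (hY.aestronglyMeasurable_dampedForcing hw c).restrict
    (Eventually.of_forall (hY.norm_dampedForcing_le hw0 c))

theorem norm_exp_mul_integral_dampedForcing_le (hY : IsForcing w Y W) (hw : Continuous w)
    (hw0 : ∀ ξ, 0 ≤ w ξ) {c : ℂ} (hc : 0 < c.re) {ξ R : ℝ} (hR : ξ ≤ R) :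
    ‖Complex.exp (c * travelTime w ξ) * ∫ η in ξ..R, dampedForcing w Y c η‖ ≤
      (2 * c.re)⁻¹ + ∫ η, W η := by
  have hexp := (continuous_mul_exp_travelTime hw (2 * c.re) ξ).intervalIntegrable (μ := volume) ξ R
  have hE := hY.intervalIntegrable_dampedForcing hw hw0 c ξ R
  calc ‖Complex.exp (c * travelTime w ξ) * ∫ η in ξ..R, dampedForcing w Y c η‖
      ≤ ∫ η in ξ..R, ‖Complex.exp (c * travelTime w ξ)‖ * ‖dampedForcing w Y c η‖ := by
        rw [norm_mul, intervalIntegral.integral_const_mul]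
        gcongr
        exact intervalIntegral.norm_integral_le_integral_norm hR
    _ ≤ ∫ η in ξ..R, (w η * Real.exp (-(2 * c.re) * (travelTime w η - travelTime w ξ)) + W η) :=
        intervalIntegral.integral_mono_on hR (hE.norm.const_mul _)
          (hexp.add hY.integrable.intervalIntegrable)
          fun η _ => hY.norm_exp_mul_norm_dampedForcing_le hw0 c ξ η
    _ = (∫ η in ξ..R, w η * Real.exp (-(2 * c.re) * (travelTime w η - travelTime w ξ))) +
          ∫ η in ξ..R, W η :=
        intervalIntegral.integral_add hexp hY.integrable.intervalIntegrable
    _ ≤ (2 * c.re)⁻¹ + ∫ η, W η := by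
        refine add_le_add (integral_mul_exp_travelTime_le hw (mul_pos two_pos hc) ξ R) ?_
        rw [intervalIntegral.integral_of_le hR]
        exact setIntegral_le_integral hY.integrable (Eventually.of_forall hY.nonneg)

theorem locallyAbsolutelyContinuous_variationOfConstants (hY : IsForcing w Y W)
    (hw : Continuous w) (hw0 : ∀ ξ, 0 ≤ w ξ) (c C : ℂ) :
    LocallyAbsolutelyContinuous (variationOfConstants w Y c C) := fun a b ha hab =>
  (locallyAbsolutelyContinuous_exp_travelTime hw c a b ha hab).fun_smul
    (((LocallyAbsolutelyContinuous.integral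
      (hY.intervalIntegrable_dampedForcing hw hw0 c 0)).const_sub C) a b ha hab)

theorem ae_hasDerivAt_variationOfConstants (hY : IsForcing w Y W)
    (hw : Continuous w) (hw0 : ∀ ξ, 0 ≤ w ξ) (c C : ℂ) :
    ∀ᵐ ξ, HasDerivAt (variationOfConstants w Y c C)
      (c * w ξ * variationOfConstants w Y c C ξ - Y ξ) ξ := by
  have hE : LocallyIntegrable (dampedForcing w Y c) := fun ξ =>
    ⟨Ioc (ξ - 1) (ξ + 1), Ioc_mem_nhds (sub_one_lt ξ) (lt_add_one ξ),
      (hY.intervalIntegrable_dampedForcing hw hw0 c _ _).1⟩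
  filter_upwards [LocallyIntegrable.ae_hasDerivAt_integral hE] with ξ hξ
  have hcancel : Complex.exp (c * travelTime w ξ) * dampedForcing w Y c ξ = Y ξ := by
    rw [dampedForcing, ← mul_assoc, ← Complex.exp_add, neg_mul, add_neg_cancel, Complex.exp_zero,
      one_mul]
  refine ((hasDerivAt_exp_travelTime hw c ξ).mul ((hξ 0).const_sub C)).congr_deriv ?_
  rw [mul_neg, hcancel, variationOfConstants]
  ring

theorem norm_variationOfConstants_le (hY : IsForcing w Y W) (hw : Continuous w)
    (hw0 : ∀ ξ, 0 ≤ w ξ) {c : ℂ} (hc : 0 < c.re) (ξ : ℝ) :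
    ‖variationOfConstants w Y c (∫ η in Ioi 0, dampedForcing w Y c η) ξ‖ ≤
      (2 * c.re)⁻¹ + ∫ η, W η := by
  have hE := hY.intervalIntegrable_dampedForcing hw hw0 c
  have hlim : Tendsto (fun R : ℝ => ∫ η in ξ..R, dampedForcing w Y c η) atTop
      (𝓝 ((∫ η in Ioi 0, dampedForcing w Y c η) - ∫ η in (0 : ℝ)..ξ, dampedForcing w Y c η)) :=
    ((intervalIntegral_tendsto_integral_Ioi 0 (hY.integrableOn_dampedForcing hw hw0 hc)
      tendsto_id).sub_const _).congr fun R =>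
        intervalIntegral.integral_interval_sub_left (hE 0 R) (hE 0 ξ)
  refine le_of_tendsto (hlim.const_mul _).norm ?_
  filter_upwards [eventually_ge_atTop ξ] with R hR
  exact hY.norm_exp_mul_integral_dampedForcing_le hw hw0 hc hR

end IsForcing

theorem variationOfConstants_zero (w : ℝ → ℝ) (Y : ℝ → ℂ) (c C : ℂ) :
    variationOfConstants w Y c C 0 = C := by
  rw [variationOfConstants, travelTime_zero, Complex.ofReal_zero, mul_zero, Complex.exp_zero,
    one_mul, intervalIntegral.integral_same, sub_zero]

theorem IsForcing.integrableOn_mul_norm_sq {Y f : ℝ → ℂ} {W : ℝ → ℝ} (hY : IsForcing w Y W)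
    (hw : Continuous w) (hw0 : ∀ ξ, 0 ≤ w ξ) {σ K : ℝ} (hσ : σ * σ = 1) {s : ℂ} (hs : 0 < s.re)
    (hf : LocallyAbsolutelyContinuous f)
    (hderiv : ∀ᵐ ξ ∂(volume.restrict (Ici (0 : ℝ))),
      HasDerivAt f (σ * s * w ξ * f ξ - Y ξ) ξ)
    (hK : ∀ N, 0 ≤ N → σ * (‖f N‖ ^ 2 - ‖f 0‖ ^ 2) ≤ K) :
    IntegrableOn (fun ξ => w ξ * ‖f ξ‖ ^ 2) (Ici 0) := by
  have hinner (ξ : ℝ) : s.re * (w ξ * ‖f ξ‖ ^ 2) ≤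
      σ * (2 * ⟪f ξ, σ * s * w ξ * f ξ - Y ξ⟫_ℝ) + s.re⁻¹ * W ξ := by
    have hmain : ⟪f ξ, σ * s * w ξ * f ξ⟫_ℝ = σ * (s.re * (w ξ * ‖f ξ‖ ^ 2)) := by
      rw [Complex.inner, ← Complex.normSq_eq_norm_sq]
      simp only [Complex.mul_re, Complex.mul_im, Complex.ofReal_re, Complex.ofReal_im,
        Complex.conj_re, Complex.conj_im, Complex.normSq_apply]
      ring
    have hforce : σ * ⟪f ξ, Y ξ⟫_ℝ ≤ ‖f ξ‖ * ‖Y ξ‖ := by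
      refine (le_abs_self _).trans ?_
      rw [abs_mul, (abs_eq zero_le_one).2 (mul_self_eq_one_iff.1 hσ), one_mul]
      exact abs_real_inner_le_norm _ _
    have hyoung : 2 * (‖f ξ‖ * ‖Y ξ‖) ≤ s.re * (w ξ * ‖f ξ‖ ^ 2) + s.re⁻¹ * W ξ := by
      have h := mul_le_mul_of_nonneg_left (hY.two_mul_mul_norm_le hw0 (s.re * ‖f ξ‖) ξ)
        (inv_nonneg.2 hs.le)
      field_simp at h ⊢
      linarith
    rw [inner_sub_right, hmain]
    linear_combination 2 * hforce + hyoung - 2 * (s.re * (w ξ * ‖f ξ‖ ^ 2)) * hσ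
  have hint := hf.integrableOn_of_le_inner hderiv (q := fun ξ => s.re * (w ξ * ‖f ξ‖ ^ 2))
    (continuousOn_const.mul (hw.continuousOn.mul (hf.continuousOn.norm.pow 2)))
    (fun ξ _ => mul_nonneg hs.le (mul_nonneg (hw0 ξ) (sq_nonneg _)))
    (hY.integrable.integrableOn.const_mul s.re⁻¹)
    (fun ξ _ => mul_nonneg (inv_nonneg.2 hs.le) (hY.nonneg ξ)) (fun ξ _ => hinner ξ) hK
  refine (hint.const_mul s.re⁻¹).congr (Eventually.of_forall fun ξ => ?_)
  exact inv_mul_cancel_left₀ hs.ne' _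

/-- Going outwards (`σ = 1`) only one solution is bounded, which determines its value at `0`; going
inwards (`σ = -1`) every solution is admissible and the value at `0` can be prescribed. -/
theorem IsForcing.exists_solution {Y : ℝ → ℂ} {W : ℝ → ℝ} (hY : IsForcing w Y W)
    (hw : Continuous w) (hw0 : ∀ ξ, 0 ≤ w ξ) {σ : ℝ} (hσ : σ * σ = 1) {s : ℂ} (hs : 0 < s.re) :
    ∃ f : ℝ → ℂ, LocallyAbsolutelyContinuous f ∧
      (∀ᵐ ξ ∂(volume.restrict (Ici (0 : ℝ))), HasDerivAt f (σ * s * w ξ * f ξ - Y ξ) ξ) ∧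
      IntegrableOn (fun ξ => w ξ * ‖f ξ‖ ^ 2) (Ici 0) ∧ (σ = -1 → f 0 = 0) := by
  suffices h : ∃ C : ℂ, (σ = -1 → C = 0) ∧ ∃ K, ∀ N, 0 ≤ N →
      σ * (‖variationOfConstants w Y (σ * s) C N‖ ^ 2 - ‖C‖ ^ 2) ≤ K by
    obtain ⟨C, hC, K, hK⟩ := h
    have hac := hY.locallyAbsolutelyContinuous_variationOfConstants hw hw0 (σ * s) C
    have hderiv := ae_restrict_of_ae (s := Ici (0 : ℝ))
      (hY.ae_hasDerivAt_variationOfConstants hw hw0 (σ * s) C)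
    refine ⟨_, hac, hderiv, hY.integrableOn_mul_norm_sq (K := K) hw hw0 hσ hs hac hderiv ?_, ?_⟩
    all_goals rwa [variationOfConstants_zero]
  rcases mul_self_eq_one_iff.1 hσ with rfl | rfl
  · have hre : 0 < (((1 : ℝ) : ℂ) * s).re := by rwa [Complex.ofReal_one, one_mul]
    refine ⟨∫ η in Ioi 0, dampedForcing w Y ((1 : ℝ) * s) η, fun h => absurd h (by norm_num),
      ((2 * (((1 : ℝ) : ℂ) * s).re)⁻¹ + ∫ η, W η) ^ 2, fun N _ => ?_⟩
    rw [one_mul]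
    exact (sub_le_self _ (sq_nonneg _)).trans
      (pow_le_pow_left₀ (norm_nonneg _) (hY.norm_variationOfConstants_le hw hw0 hre N) 2)
  · refine ⟨0, fun _ => rfl, 0, fun N _ => ?_⟩
    rw [norm_zero, zero_pow two_ne_zero, sub_zero, neg_one_mul]
    exact neg_nonpos.2 (sq_nonneg _)

namespace IsTransportSpeed

variable {δ : ℝ → ℝ} {σ : ℝ}

theorem sign_mul_slowness_mul (hδ : IsTransportSpeed δ σ) {ξ : ℝ} (hξ : 0 ≤ ξ) (x : ℂ) :
    σ * slowness δ ξ * (δ ξ * x) = x := by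
  have hσ : (σ : ℂ) * (δ ξ * slowness δ ξ) = 1 := by
    rw [← Complex.ofReal_mul, hδ.mul_slowness hξ, ← Complex.ofReal_mul, hδ.sign_mul_sign,
      Complex.ofReal_one]
  linear_combination x * hσ

theorem isForcing_indicator (hδ : IsTransportSpeed δ σ) (y : Lp ℂ 2 (weightedMeasure δ)) :
    IsForcing (slowness δ) ((Ici 0).indicator y)
      ((Ici 0).indicator fun ξ => |δ ξ| * ‖y ξ‖ ^ 2) where
  aestronglyMeasurable := by
    rw [aestronglyMeasurable_indicator_iff measurableSet_Ici]
    refine (Lp.aestronglyMeasurable y).mono_ac (Measure.ae_le_iff_absolutelyContinuous.1 ?_)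
    exact (ae_weightedMeasure hδ.continuousOn fun _ => hδ.ne_zero).ge
  integrable :=
    (integrableOn_abs_mul_norm_sq hδ.continuousOn y).integrable_indicator measurableSet_Ici
  nonneg ξ := indicator_nonneg (fun ξ _ => mul_nonneg (abs_nonneg _) (sq_nonneg _)) ξ
  norm_sq_le ξ := by
    by_cases hξ : ξ ∈ Ici (0 : ℝ)
    · rw [indicator_of_mem hξ, indicator_of_mem hξ, slowness, max_eq_left (mem_Ici.1 hξ),
        inv_mul_cancel_left₀ (abs_ne_zero.2 (hδ.ne_zero hξ))]
    · rw [indicator_of_notMem hξ, indicator_of_notMem hξ, norm_zero, mul_zero, zero_pow two_ne_zero]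

theorem exists_isWeightedRep_resolvent (hδ : IsTransportSpeed δ σ) {s : ℂ} (hs : 0 < s.re)
    (y : Lp ℂ 2 (weightedMeasure δ)) :
    ∃ x f, IsWeightedRep δ x f (s • x - y) ∧ (σ = -1 → f 0 = 0) := by
  obtain ⟨f, hac, hderiv, hint, hf0⟩ := (hδ.isForcing_indicator y).exists_solution
    hδ.continuous_slowness (fun ξ => (hδ.slowness_pos ξ).le) hδ.sign_mul_sign hs
  obtain ⟨x, hx⟩ := hδ.exists_lp_eq_mul
    (hac.continuousOn.aestronglyMeasurable measurableSet_Ici) hint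
  refine ⟨x, f, ⟨hac, hx, ?_⟩, hf0⟩
  filter_upwards [hx, hderiv, hδ.ae_of_ae (Lp.coeFn_sub (s • x) y),
    hδ.ae_of_ae (Lp.coeFn_smul s x), ae_restrict_mem measurableSet_Ici] with ξ h1 h2 h3 h4 hξ
  refine h2.congr_deriv ?_
  rw [h3, Pi.sub_apply, h4, Pi.smul_apply, indicator_of_mem hξ, h1, smul_eq_mul, mul_right_comm _ s,
    mul_right_comm _ s, hδ.sign_mul_slowness_mul hξ, mul_comm]

theorem exists_isWeightedRep_eigenfunction (hδ : IsTransportSpeed δ σ) {s : ℂ}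
    (hs : σ * s.re < 0) : ∃ x f, IsWeightedRep δ x f (s • x) ∧ f 0 = 1 := by
  let f : ℝ → ℂ := fun ξ => Complex.exp (σ * s * travelTime (slowness δ) ξ)
  have hw := hδ.continuous_slowness
  have hint : IntegrableOn (fun ξ => slowness δ ξ * ‖f ξ‖ ^ 2) (Ici 0) := by
    rw [integrableOn_Ici_iff_integrableOn_Ioi]
    refine (integrableOn_mul_exp_travelTime hw (fun ξ => (hδ.slowness_pos ξ).le)
      (mul_pos two_pos (neg_pos.2 hs))).congr (Eventually.of_forall fun ξ => ?_)
    simp only [f, norm_exp_mul_ofReal, ← Real.exp_nat_mul, Complex.re_ofReal_mul]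
    push_cast
    ring_nf
  obtain ⟨x, hx⟩ := hδ.exists_lp_eq_mul
    (continuous_exp_travelTime hw (σ * s)).aestronglyMeasurable hint
  refine ⟨x, f, ⟨locallyAbsolutelyContinuous_exp_travelTime hw (σ * s), hx, ?_⟩, ?_⟩
  · filter_upwards [hx, hδ.ae_of_ae (Lp.coeFn_smul s x),
      ae_restrict_mem measurableSet_Ici] with ξ h1 h2 hξ
    refine (hasDerivAt_exp_travelTime hw (σ * s) ξ).congr_deriv ?_
    have hfx : σ * slowness δ ξ * f ξ = x ξ := by
      rw [show f ξ = δ ξ * x ξ from h1, hδ.sign_mul_slowness_mul hξ]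
    rw [h2, Pi.smul_apply, smul_eq_mul, ← hfx]
    ring
  · simp only [f, travelTime_zero, Complex.ofReal_zero, mul_zero, Complex.exp_zero]

end IsTransportSpeed

end TransportEquation

section BoundarySystem

open scoped InnerProductSpace

theorem exists_hasDerivAt_eqOn_Icc {E : Type*} [NormedAddCommGroup E] [NormedSpace ℝ E]
    [CompleteSpace E] {a b : ℝ} (hab : a < b) {g : ℝ → E} (hg : ContDiffOn ℝ 1 g (Icc a b)) :
    ∃ G G' : ℝ → E, (∀ t, HasDerivAt G (G' t) t) ∧ Continuous G' ∧ EqOn G g (Icc a b) := by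
  let G' : ℝ → E := IccExtend hab.le ((Icc a b).domRestrict (derivWithin g (Icc a b)))
  have hG' : Continuous G' :=
    (hg.continuousOn_derivWithin (uniqueDiffOn_Icc hab) le_rfl).domRestrict.Icc_extend'
  refine ⟨fun t => g a + ∫ s in a..t, G' s, G', fun t =>
    ((hG'.integral_hasStrictDerivAt a t).hasDerivAt).const_add _, hG', fun t ht => ?_⟩
  have hsub : Icc a t ⊆ Icc a b := Icc_subset_Icc_right ht.2
  have hderiv (r : ℝ) (hr : r ∈ Ioo a t) : HasDerivAt g (G' r) r := by
    have hr' : r ∈ Icc a b := hsub (Ioo_subset_Icc_self hr)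
    rw [show G' r = derivWithin g (Icc a b) r from IccExtend_of_mem hab.le _ hr']
    exact ((hg.differentiableOn one_ne_zero) r hr').hasDerivWithinAt.hasDerivAt
      (Icc_mem_nhds hr.1 (hr.2.trans_le ht.2))
  have hftc := intervalIntegral.integral_eq_sub_of_hasDerivAt_of_le ht.1
    (hg.continuousOn.mono hsub) hderiv (hG'.intervalIntegrable _ _)
  simp only [hftc, add_sub_cancel]

namespace BoundarySystem

variable {X U Y : Type*}
  [NormedAddCommGroup X] [InnerProductSpace ℂ X] [CompleteSpace X]
  [NormedAddCommGroup U] [InnerProductSpace ℂ U] [CompleteSpace U]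
  [NormedAddCommGroup Y] [InnerProductSpace ℂ Y] [CompleteSpace Y]
  {S : BoundarySystem X U Y}

theorem mem_restrictedOp_domain {x : X} :
    x ∈ S.restrictedOp.domain ↔
      ∃ h : x ∈ S.opA.domain, S.opB ⟨x, S.domain_le h⟩ = 0 := by
  constructor
  · rintro ⟨⟨w, hw, rfl⟩, h⟩
    exact ⟨h, hw⟩
  · rintro ⟨h, h0⟩
    exact ⟨⟨⟨x, S.domain_le h⟩, h0, rfl⟩, h⟩

theorem restrictedOp_apply (x : S.restrictedOp.domain) :
    S.restrictedOp x = S.opA ⟨x, S.restrictedOp_domain_le x.2⟩ :=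
  LinearPMap.domRestrict_apply rfl

/-- The infinitesimal form `2 Re ⟨x, 𝒜 x⟩ = ‖ℬ x‖² - ‖𝒞 x‖²` of scattering energy
preservation. -/
def IsEnergyPreserving (S : BoundarySystem X U Y) : Prop :=
  ∀ x : S.opA.domain, 2 * (⟪(x : X), S.opA x⟫_ℂ).re =
    ‖S.opB ⟨x, S.domain_le x.2⟩‖ ^ 2 - ‖S.opC x‖ ^ 2

namespace IsEnergyPreserving

theorem two_mul_re_inner_restrictedOp (hS : S.IsEnergyPreserving) (x : S.restrictedOp.domain) :
    2 * (⟪(x : X), S.restrictedOp x⟫_ℂ).re =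
      -‖S.opC ⟨x, S.restrictedOp_domain_le x.2⟩‖ ^ 2 := by
  obtain ⟨h, h0⟩ := mem_restrictedOp_domain.1 x.2
  rw [restrictedOp_apply, hS ⟨x, h⟩, h0, norm_zero]
  ring

theorem isDissipative (hS : S.IsEnergyPreserving) : IsDissipative S.restrictedOp := fun x => by
  linarith [hS.two_mul_re_inner_restrictedOp x,
    sq_nonneg ‖S.opC ⟨x, S.restrictedOp_domain_le x.2⟩‖]

theorem norm_opC_le (hS : S.IsEnergyPreserving) (x : S.restrictedOp.domain) :
    ‖S.opC ⟨x, S.restrictedOp_domain_le x.2⟩‖ ≤ ‖(x : X)‖ + ‖S.restrictedOp x‖ := by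
  refine abs_le_of_sq_le_sq' ?_ (by positivity) |>.2
  have hcauchy : |(⟪(x : X), S.restrictedOp x⟫_ℂ).re| ≤ ‖(x : X)‖ * ‖S.restrictedOp x‖ :=
    (Complex.abs_re_le_norm _).trans (norm_inner_le_norm _ _)
  nlinarith [hS.two_mul_re_inner_restrictedOp x,
    neg_abs_le (⟪(x : X), S.restrictedOp x⟫_ℂ).re, sq_nonneg ‖(x : X)‖,
    sq_nonneg ‖S.restrictedOp x‖]

theorem energyBalance (hS : S.IsEnergyPreserving) : S.EnergyBalance := by
  intro τ x₀ u x y _ hx t ht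
  obtain ⟨h, hd, hu, hy⟩ := hx.equations t ht
  have henergy := hS ⟨x t, h⟩
  rw [hu, hy] at henergy
  rw [← henergy]
  let := InnerProductSpace.rclikeToReal ℂ X
  exact hd.norm_sq

end IsEnergyPreserving

namespace IsClassicalSolution

variable {τ : ℝ} {x₀ x₀' : X} {u u' : ℝ → U} {x x' : ℝ → X} {y y' : ℝ → Y}

theorem sub (h : S.IsClassicalSolution τ x₀ u x y) (h' : S.IsClassicalSolution τ x₀' u' x' y') :
    S.IsClassicalSolution τ (x₀ - x₀') (u - u') (x - x') (y - y') where
  initial := by rw [Pi.sub_apply, h.initial, h'.initial]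
  contDiffOn := h.contDiffOn.sub h'.contDiffOn
  equations t ht := by
    obtain ⟨hm, hd, hu, hy⟩ := h.equations t ht
    obtain ⟨hm', hd', hu', hy'⟩ := h'.equations t ht
    refine ⟨S.opA.domain.sub_mem hm hm', ?_, ?_, ?_⟩
    · exact S.opA.map_sub ⟨x t, hm⟩ ⟨x' t, hm'⟩ ▸ hd.sub hd'
    · exact (S.opB.map_sub ⟨x t, S.domain_le hm⟩ ⟨x' t, S.domain_le hm'⟩).trans
        (by rw [hu, hu', Pi.sub_apply])
    · exact (S.opC.map_sub ⟨x t, hm⟩ ⟨x' t, hm'⟩).trans (by rw [hy, hy', Pi.sub_apply])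

theorem eqOn (hS : S.EnergyBalance) (hτ : 0 < τ)
    (h : S.IsClassicalSolution τ x₀ u x y) (h' : S.IsClassicalSolution τ x₀ u x' y') :
    EqOn x x' (Icc 0 τ) := by
  have hd := hS τ _ _ _ _ hτ (h.sub h')
  have hanti : AntitoneOn (fun r => ‖(x - x') r‖ ^ 2) (Icc 0 τ) := by
    refine antitoneOn_of_hasDerivWithinAt_nonpos (convex_Icc _ _)
      (fun t ht => (hd t ht).continuousWithinAt)
      (fun t ht => (hd t (interior_subset ht)).mono interior_subset) fun t _ => ?_
    simp only [Pi.sub_apply, sub_self, norm_zero]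
    nlinarith [sq_nonneg ‖y t - y' t‖]
  intro t ht
  have hle := hanti ⟨le_rfl, hτ.le⟩ ht ht.1
  simp only [Pi.sub_apply, h.initial, h'.initial, sub_self, norm_zero] at hle
  have hnorm : ‖x t - x' t‖ = 0 := by nlinarith [norm_nonneg (x t - x' t)]
  exact sub_eq_zero.1 (norm_eq_zero.1 hnorm)

theorem continuousOn_norm_sq_output (hS : S.IsEnergyPreserving) (hτ : 0 < τ)
    (h : S.IsClassicalSolution τ x₀ u x y) (hu : ContinuousOn u (Icc 0 τ)) :
    ContinuousOn (fun t => ‖y t‖ ^ 2) (Icc 0 τ) := by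
  have hUD : UniqueDiffOn ℝ (Icc 0 τ) := uniqueDiffOn_Icc hτ
  have hx' : ContinuousOn (derivWithin x (Icc 0 τ)) (Icc 0 τ) :=
    h.contDiffOn.continuousOn_derivWithin hUD le_rfl
  have hcont : ContinuousOn
      (fun t => ‖u t‖ ^ 2 - 2 * (⟪x t, derivWithin x (Icc 0 τ) t⟫_ℂ).re) (Icc 0 τ) :=
    (hu.norm.pow 2).sub ((Complex.continuous_re.comp_continuousOn
      (h.contDiffOn.continuousOn.inner hx')).const_mul 2)
  refine hcont.congr fun t ht => ?_
  obtain ⟨hm, hd, hu, hy⟩ := h.equations t ht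
  have henergy := hS ⟨x t, hm⟩
  rw [hu, hy] at henergy
  simp only [hd.derivWithin (hUD t ht), henergy, sub_sub_cancel]

theorem norm_sq_add_integral (hS : S.IsEnergyPreserving) (hτ : 0 < τ)
    (h : S.IsClassicalSolution τ x₀ u x y) (hu : ContinuousOn u (Icc 0 τ)) :
    IntervalIntegrable (fun t => ‖y t‖ ^ 2) volume 0 τ ∧
    ‖x τ‖ ^ 2 + ∫ t in (0 : ℝ)..τ, ‖y t‖ ^ 2 = ‖x₀‖ ^ 2 + ∫ t in (0 : ℝ)..τ, ‖u t‖ ^ 2 := by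
  have hd := hS.energyBalance τ _ _ _ _ hτ h
  have hyi : IntervalIntegrable (fun t => ‖y t‖ ^ 2) volume 0 τ :=
    (h.continuousOn_norm_sq_output hS hτ hu).intervalIntegrable_of_Icc hτ.le
  have hui : IntervalIntegrable (fun t => ‖u t‖ ^ 2) volume 0 τ :=
    (hu.norm.pow 2).intervalIntegrable_of_Icc hτ.le
  have hftc := intervalIntegral.integral_eq_sub_of_hasDerivAt_of_le hτ.le
    (fun t ht => (hd t ht).continuousWithinAt)
    (fun t ht => (hd t (Ioo_subset_Icc_self ht)).hasDerivAt (Icc_mem_nhds ht.1 ht.2))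
    (hui.sub hyi)
  rw [intervalIntegral.integral_sub hui hyi, h.initial] at hftc
  exact ⟨hyi, by linarith⟩

end IsClassicalSolution

theorem exists_isClassicalSolution {τ : ℝ} (hτ : 0 < τ) {u : ℝ → U} {x x' : ℝ → X}
    (hd : ∀ t ∈ Icc 0 τ, HasDerivWithinAt x (x' t) (Icc 0 τ) t) (hx' : ContinuousOn x' (Icc 0 τ))
    (hx : ∀ t ∈ Icc 0 τ, ∃ h : x t ∈ S.opA.domain,
      S.opA ⟨x t, h⟩ = x' t ∧ S.opB ⟨x t, S.domain_le h⟩ = u t) :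
    ∃ y, S.IsClassicalSolution τ (x 0) u x y := by
  classical
  refine ⟨fun t => if h : x t ∈ S.opA.domain then S.opC ⟨x t, h⟩ else 0, rfl, ?_, fun t ht => ?_⟩
  · have hUD : UniqueDiffOn ℝ (Icc 0 τ) := uniqueDiffOn_Icc hτ
    rw [contDiffOn_one_iff_derivWithin hUD]
    exact ⟨fun t ht => (hd t ht).differentiableWithinAt,
      hx'.congr fun t ht => (hd t ht).derivWithin (hUD t ht)⟩
  · obtain ⟨h, hA, hB⟩ := hx t ht
    exact ⟨h, hA ▸ hd t ht, hB, by rw [dif_pos h]⟩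

namespace Lifting

theorem nonempty_of_surjective [FiniteDimensional ℂ U]
    (h : Function.Surjective fun x : S.opA.domain => S.opB ⟨x, S.domain_le x.2⟩) :
    Nonempty S.Lifting := by
  let b : S.opA.domain →ₗ[ℂ] U := S.opB.toFun ∘ₗ Submodule.inclusion S.domain_le
  obtain ⟨r, hr⟩ := b.exists_rightInverse_of_surjective (LinearMap.range_eq_top.2 h)
  exact ⟨{
    op := (S.opA.domain.subtype ∘ₗ r).toContinuousLinearMap
    mem := fun u => (r u).2
    bounded := ⟨_, (S.opA.toFun ∘ₗ r).toContinuousLinearMap.le_opNorm⟩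
    right_inv := LinearMap.congr_fun hr }⟩

/-- The bounded operator `𝒜 B`. -/
noncomputable def opA (B : S.Lifting) : U →L[ℂ] X :=
  (S.opA.toFun ∘ₗ B.op.toLinearMap.codRestrict S.opA.domain B.mem).mkContinuousOfExistsBound
    B.bounded

theorem sub_mem_restrictedOp_domain (B : S.Lifting) (x : S.opA.domain) :
    (x : X) - B.op (S.opB ⟨x, S.domain_le x.2⟩) ∈ S.restrictedOp.domain := by
  refine mem_restrictedOp_domain.2 ⟨S.opA.domain.sub_mem x.2 (B.mem _), ?_⟩
  exact (S.opB.map_sub ⟨x, S.domain_le x.2⟩ ⟨B.op _, S.domain_le (B.mem _)⟩).trans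
    (by rw [B.right_inv, sub_self])

theorem add_mem_domain (B : S.Lifting) {v z : X} (h : (v, z) ∈ S.restrictedOp.graph) (u : U) :
    ∃ hm : v + B.op u ∈ S.opA.domain,
      S.opA ⟨v + B.op u, hm⟩ = z + B.opA u ∧ S.opB ⟨v + B.op u, S.domain_le hm⟩ = u := by
  obtain ⟨⟨v, hv⟩, rfl, rfl⟩ := (LinearPMap.mem_graph_iff _).1 h
  obtain ⟨hv, hB⟩ := mem_restrictedOp_domain.1 hv
  refine ⟨S.opA.domain.add_mem hv (B.mem u), ?_, ?_⟩
  · rw [restrictedOp_apply]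
    exact S.opA.map_add ⟨v, hv⟩ ⟨B.op u, B.mem u⟩
  · exact (S.opB.map_add ⟨v, S.domain_le hv⟩ ⟨B.op u, S.domain_le (B.mem u)⟩).trans
      (by rw [hB, B.right_inv, zero_add])

/-- The difference `v = x - B u` solves `v̇ = A v + 𝒜 B u - B u̇`, a homogeneous boundary value
problem with a `C¹` forcing term. -/
theorem exists_isClassicalSolution (B : S.Lifting) {T : ℝ → X →L[ℂ] X}
    (hT : IsContractionSemigroup T) (hA : IsGeneratorOf S.restrictedOp T) {τ : ℝ} (hτ : 0 < τ)
    (x₀ : S.opA.domain) {u : ℝ → U} (hu : ContDiffOn ℝ 2 u (Icc 0 τ))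
    (hu₀ : u 0 = S.opB ⟨x₀, S.domain_le x₀.2⟩) :
    ∃ x y, S.IsClassicalSolution τ x₀ u x y := by
  let u' := derivWithin u (Icc 0 τ)
  have hu' : ContDiffOn ℝ 1 u' (Icc 0 τ) := hu.derivWithin (uniqueDiffOn_Icc hτ) (by norm_num)
  have hud (t : ℝ) (ht : t ∈ Icc 0 τ) : HasDerivWithinAt u (u' t) (Icc 0 τ) t :=
    (hu.differentiableOn two_ne_zero t ht).hasDerivWithinAt
  let L : U →L[ℝ] X := B.op.restrictScalars ℝ
  have hforcing : ContDiffOn ℝ 1 (fun t => B.opA (u t) - B.op (u' t)) (Icc 0 τ) :=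
    ((B.opA.restrictScalars ℝ).contDiff.comp_contDiffOn (hu.of_le (by norm_num))).sub
      (L.contDiff.comp_contDiffOn hu')
  obtain ⟨F, F', hF, hF', hFeq⟩ := exists_hasDerivAt_eqOn_Icc hτ hforcing
  obtain ⟨v, v', hv0, hv', hv⟩ :=
    hA.exists_solution hT hF hF' ⟨_, B.sub_mem_restrictedOp_domain x₀⟩
  obtain ⟨y, hy⟩ := S.exists_isClassicalSolution hτ (u := u) (x := fun t => v t + B.op (u t))
    (x' := fun t => v' t + B.op (u' t))
    (fun t ht => ((hv t ht.1).1.mono Icc_subset_Ici_self).add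
      (L.hasFDerivAt.comp_hasDerivWithinAt t (hud t ht)))
    (hv'.continuousOn.add (B.op.continuous.comp_continuousOn hu'.continuousOn))
    fun t ht => by
      obtain ⟨hm, hopA, hopB⟩ := B.add_mem_domain (hv t ht.1).2 (u t)
      have hFt : F t = B.opA (u t) - B.op (u' t) := hFeq ht
      exact ⟨hm, hopA.trans (by rw [hFt]; abel), hopB⟩
  have hinit : v 0 + B.op (u 0) = x₀ := by rw [hv0, hu₀, sub_add_cancel]
  exact ⟨_, y, hinit ▸ hy⟩

end Lifting

namespace IsEnergyPreserving

theorem wellPosed (hS : S.IsEnergyPreserving) (hA : IsMaximalDissipative S.restrictedOp)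
    (B : S.Lifting) : S.WellPosed := by
  intro τ hτ
  refine ⟨1, one_pos, fun x₀ u hu hu₀ => ?_⟩
  obtain ⟨T, hT, hgen⟩ := hA.exists_isContractionSemigroup
  obtain ⟨x, y, hx⟩ := B.exists_isClassicalSolution hT hgen hτ x₀ hu hu₀
  obtain ⟨hint, heq⟩ := hx.norm_sq_add_integral hS hτ hu.continuousOn
  exact ⟨x, y, hx, fun x' y' hx' => hx'.eqOn hS.energyBalance hτ hx, hint, by rw [one_mul, heq]⟩

theorem isBoundaryControlSystem (hS : S.IsEnergyPreserving)
    (hA : IsMaximalDissipative S.restrictedOp) (B : S.Lifting) : S.IsBoundaryControlSystem :=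
  let ⟨T, hT, hgen⟩ := hA.exists_isContractionSemigroup
  ⟨⟨T, hT.toIsC0Semigroup, hgen⟩, ⟨B⟩, 1, fun x => by simpa using hS.norm_opC_le x⟩

end IsEnergyPreserving

/-- The eigenvector is `(s - A)⁻¹ (𝒜 B - s B) u + B u`. -/
theorem exists_transferFunction_eq_opC (B : S.Lifting) (s : ℂ)
    (hs : s ∈ unboundedResolventSet S.restrictedOp) (u : U) :
    ∃ x : S.opA.domain, S.opA x = s • (x : X) ∧ S.transferFunction B s hs u = S.opC x := by
  have hR : IsResolventAt S.restrictedOp s (resolventAt S.restrictedOp s hs) := hs.choose_spec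
  obtain ⟨h, heq⟩ := hR.1 (S.opA ⟨B.op u, B.mem u⟩ - s • B.op u)
  rw [restrictedOp_apply] at heq
  refine ⟨⟨_, S.restrictedOp_domain_le h⟩ + ⟨B.op u, B.mem u⟩, ?_, (map_add S.opC _ _).symm⟩
  rw [S.opA.map_add, Submodule.coe_add]
  linear_combination (norm := module) -heq

end BoundarySystem

end BoundarySystem

namespace SignedDiagonal

open scoped InnerProductSpace

variable {p m : ℕ} {D : SignedDiagonal p m}

/-- The signs of the diagonal entries of `Δ`: `1` for the `λ`'s, `-1` for the `θ`'s. -/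
def entrySign (p m : ℕ) : Fin p ⊕ Fin m → ℝ := Sum.elim (fun _ => 1) fun _ => -1

theorem isTransportSpeed (D : SignedDiagonal p m) :
    ∀ i, IsTransportSpeed (D.entry i) (entrySign p m i)
  | .inl k => ⟨D.entry_continuousOn _, one_mul 1, fun ξ hξ => by
      simpa [entrySign, entry] using D.lam_pos k ξ hξ⟩
  | .inr j => ⟨D.entry_continuousOn _, by simp [entrySign], fun ξ hξ => by
      simpa [entrySign, entry] using D.theta_neg j ξ hξ⟩

theorem isRepresentative_iff {x z : D.State} {f : Fin p ⊕ Fin m → ℝ → ℂ} :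
    D.IsRepresentative x f z ↔ ∀ i, IsWeightedRep (D.entry i) (x i) (f i) (z i) :=
  ⟨fun h i => ⟨h.absCont i, h.eq_mul i, h.hasDerivAt i⟩,
    fun h => ⟨fun i => (h i).absCont, fun i => (h i).eq_mul, fun i => (h i).hasDerivAt⟩⟩

namespace IsRepresentative

variable {f : Fin p ⊕ Fin m → ℝ → ℂ} {z : D.State}

theorem mem_domain {x : D.State} (h : D.IsRepresentative x f z) : x ∈ D.system.opA.domain :=
  ⟨f, z, h⟩

theorem opA_eq {x : D.system.opA.domain} (h : D.IsRepresentative x f z) : D.system.opA x = z :=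
  (D.isRepresentative x).deriv_eq h

theorem opB_apply {x : D.system.opB.domain} (h : D.IsRepresentative x f z) (j : Fin m) :
    D.system.opB x j = f (Sum.inr j) 0 :=
  (D.isRepresentative x).eqOn h _ self_mem_Ici

theorem opC_apply {x : D.system.opA.domain} (h : D.IsRepresentative x f z) (k : Fin p) :
    D.system.opC x k = f (Sum.inl k) 0 :=
  (D.isRepresentative x).eqOn h _ self_mem_Ici

theorem exists_restrictedOp_eq {x : D.State} (h : D.IsRepresentative x f z)
    (h0 : ∀ j, f (Sum.inr j) 0 = 0) :
    ∃ hx : x ∈ D.system.restrictedOp.domain, D.system.restrictedOp ⟨x, hx⟩ = z := by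
  have hB : D.system.opB ⟨x, h.mem_domain⟩ = 0 := by
    ext j
    exact (h.opB_apply j).trans (h0 j)
  refine ⟨BoundarySystem.mem_restrictedOp_domain.2 ⟨h.mem_domain, hB⟩, ?_⟩
  rw [BoundarySystem.restrictedOp_apply]
  exact h.opA_eq

theorem single {i : Fin p ⊕ Fin m} {e w : Lp ℂ 2 (weightedMeasure (D.entry i))} {g : ℝ → ℂ}
    (h : IsWeightedRep (D.entry i) e g w) :
    D.IsRepresentative (PiLp.single 2 i e) (Pi.single i g) (PiLp.single 2 i w) := by
  refine isRepresentative_iff.2 fun i' => ?_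
  rcases eq_or_ne i' i with rfl | hi
  · simpa only [PiLp.single_eq_same, Pi.single_eq_same] using h
  · rw [PiLp.single_eq_of_ne 2 hi, PiLp.single_eq_of_ne 2 hi, Pi.single_eq_of_ne hi]
    exact isRepresentative_iff.1 zero i'

theorem two_mul_re_inner_apply {x : D.State} (h : D.IsRepresentative x f z)
    {i : Fin p ⊕ Fin m} (htravel : ¬ IntegrableOn (fun ξ => |D.entry i ξ|⁻¹) (Ici 0)) :
    2 * (⟪x i, z i⟫_ℂ).re = -(entrySign p m i * ‖f i 0‖ ^ 2) :=
  (isRepresentative_iff.1 h i).two_mul_re_inner (D.isTransportSpeed i) htravel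

end IsRepresentative

theorem isEnergyPreserving
    (htravel : ∀ i, ¬ IntegrableOn (fun ξ => |D.entry i ξ|⁻¹) (Ici 0)) :
    D.system.IsEnergyPreserving := by
  intro x
  have h := D.isRepresentative x
  calc 2 * (⟪(x : D.State), D.derivative x⟫_ℂ).re
      = ∑ i, 2 * (⟪(x : D.State) i, D.derivative x i⟫_ℂ).re := by
        rw [PiLp.inner_apply, Complex.re_sum, Finset.mul_sum]
    _ = ∑ i, -(entrySign p m i * ‖D.rep x i 0‖ ^ 2) :=
        Finset.sum_congr rfl fun i _ => h.two_mul_re_inner_apply (htravel i)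
    _ = ∑ j, ‖D.rep x (Sum.inr j) 0‖ ^ 2 - ∑ k, ‖D.rep x (Sum.inl k) 0‖ ^ 2 := by
        simp only [Fintype.sum_sum_type, entrySign, Sum.elim_inl, Sum.elim_inr, one_mul, neg_mul,
          Finset.sum_neg_distrib]
        ring
    _ = ‖D.system.opB ⟨x, D.system.domain_le x.2⟩‖ ^ 2 - ‖D.system.opC x‖ ^ 2 := by
        rw [EuclideanSpace.norm_sq_eq, EuclideanSpace.norm_sq_eq]
        rfl

theorem surjective_smul_sub_restrictedOp (D : SignedDiagonal p m) {s : ℂ} (hs : 0 < s.re) :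
    Function.Surjective fun x : D.system.restrictedOp.domain =>
      s • (x : D.State) - D.system.restrictedOp x := by
  intro y
  choose x f hf hf0 using fun i => (D.isTransportSpeed i).exists_isWeightedRep_resolvent hs (y i)
  have hrep : D.IsRepresentative (WithLp.toLp 2 x) f (s • WithLp.toLp 2 x - y) :=
    isRepresentative_iff.2 hf
  obtain ⟨hx, hAx⟩ := hrep.exists_restrictedOp_eq fun j => hf0 _ rfl
  exact ⟨⟨_, hx⟩, by simp only [hAx, sub_sub_cancel]⟩

theorem isMaximalDissipative_restrictedOp
    (htravel : ∀ i, ¬ IntegrableOn (fun ξ => |D.entry i ξ|⁻¹) (Ici 0)) :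
    IsMaximalDissipative D.system.restrictedOp :=
  ⟨(isEnergyPreserving htravel).isDissipative, fun _ => D.surjective_smul_sub_restrictedOp⟩

theorem exists_isRepresentative_apply_zero (D : SignedDiagonal p m) (b : Fin p ⊕ Fin m → ℂ) :
    ∃ x f z, D.IsRepresentative x f z ∧ ∀ i, f i 0 = b i := by
  have hs (i : Fin p ⊕ Fin m) : entrySign p m i * (-(entrySign p m i : ℂ)).re < 0 := by
    rw [Complex.neg_re, Complex.ofReal_re, mul_neg, (D.isTransportSpeed i).sign_mul_sign]
    exact neg_one_lt_zero
  choose e g hg hg0 using fun i =>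
    (D.isTransportSpeed i).exists_isWeightedRep_eigenfunction (hs i)
  refine ⟨WithLp.toLp 2 fun i => b i • e i, fun i => b i • g i, WithLp.toLp 2 fun i => _,
    isRepresentative_iff.2 fun i => (hg i).smul (D.isTransportSpeed i) (b i), fun i => ?_⟩
  simp only [Pi.smul_apply, hg0, smul_eq_mul, mul_one]

theorem nonempty_lifting (D : SignedDiagonal p m) : Nonempty D.system.Lifting := by
  refine BoundarySystem.Lifting.nonempty_of_surjective fun u => ?_
  obtain ⟨x, f, z, h, h0⟩ := D.exists_isRepresentative_apply_zero (Sum.elim 0 u)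
  refine ⟨⟨x, h.mem_domain⟩, ?_⟩
  ext j
  exact (h.opB_apply j).trans (h0 (Sum.inr j))

theorem exists_restrictedOp_eigenvector (D : SignedDiagonal p m) (k : Fin p) {s : ℂ}
    (hs : s.re < 0) :
    ∃ x : D.system.restrictedOp.domain, (x : D.State) ≠ 0 ∧
      D.system.restrictedOp x = s • (x : D.State) := by
  obtain ⟨e, g, hg, hg0⟩ := (D.isTransportSpeed (Sum.inl k)).exists_isWeightedRep_eigenfunction
    (show 1 * s.re < 0 by rwa [one_mul])
  have hrep := IsRepresentative.single hg
  obtain ⟨hx, hAx⟩ := hrep.exists_restrictedOp_eq fun j => by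
    rw [Pi.single_eq_of_ne Sum.inr_ne_inl, Pi.zero_apply]
  refine ⟨⟨_, hx⟩, fun hzero => ?_, hAx.trans ?_⟩
  · replace hzero : PiLp.single 2 (Sum.inl k) e = (0 : D.State) := hzero
    rw [hzero] at hrep
    have hg_zero := hrep.eqOn IsRepresentative.zero (Sum.inl k)
      (self_mem_Ici (a := (0 : ℝ)))
    rw [Pi.single_eq_same, hg0] at hg_zero
    exact one_ne_zero hg_zero
  · rw [← PiLp.toLp_single, Pi.single_smul, WithLp.toLp_smul, PiLp.toLp_single]

theorem re_nonneg_of_mem_unboundedResolventSet (k : Fin p) {s : ℂ}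
    (hs : s ∈ unboundedResolventSet D.system.restrictedOp) : 0 ≤ s.re := by
  by_contra! hneg
  obtain ⟨v, hv0, hv⟩ := D.exists_restrictedOp_eigenvector k hneg
  obtain ⟨R, -, hR⟩ := hs
  have hRv := hR v
  rw [hv, sub_self, map_zero] at hRv
  exact hv0 hRv.symm

/-- The outgoing components of an eigenvector of `𝒜` solve `(λₖ xₖ)' = s xₖ` separately, and their
energy `‖xₖ‖²` can only be conserved if nothing leaves through `0`. -/
theorem opC_eq_zero_of_opA_eq_smul
    (htravel : ∀ i, ¬ IntegrableOn (fun ξ => |D.entry i ξ|⁻¹) (Ici 0)) {s : ℂ} (hs : 0 ≤ s.re)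
    {x : D.system.opA.domain} (hx : D.system.opA x = s • (x : D.State)) (k : Fin p) :
    D.system.opC x k = 0 := by
  have hrep : D.IsRepresentative x (D.rep x) (s • (x : D.State)) := hx ▸ D.isRepresentative x
  have henergy := hrep.two_mul_re_inner_apply (htravel (Sum.inl k))
  rw [PiLp.smul_apply, inner_smul_right, inner_self_eq_norm_sq_to_K] at henergy
  simp only [Complex.coe_algebraMap, ← Complex.ofReal_pow, Complex.re_mul_ofReal, entrySign,
    Sum.elim_inl, one_mul] at henergy
  have hnonneg : 0 ≤ s.re * ‖(x : D.State) (Sum.inl k)‖ ^ 2 := by positivity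
  have hzero : ‖D.rep x (Sum.inl k) 0‖ ^ 2 ≤ 0 := by linarith
  rw [hrep.opC_apply]
  exact norm_eq_zero.1 (pow_eq_zero_iff two_ne_zero |>.1 (hzero.antisymm (sq_nonneg _)))

theorem transferFunction_eq_zero
    (htravel : ∀ i, ¬ IntegrableOn (fun ξ => |D.entry i ξ|⁻¹) (Ici 0)) (B : D.system.Lifting)
    (s : ℂ) (hs : s ∈ unboundedResolventSet D.system.restrictedOp)
    (u : EuclideanSpace ℂ (Fin m)) : D.system.transferFunction B s hs u = 0 := by
  obtain ⟨x, hx, hG⟩ := BoundarySystem.exists_transferFunction_eq_opC B s hs u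
  rw [hG]
  ext k
  exact opC_eq_zero_of_opA_eq_smul htravel (re_nonneg_of_mem_unboundedResolventSet k hs) hx k

end SignedDiagonal

theorem lemma4p7_general {p m : ℕ} (D : SignedDiagonal p m)
    (htravel : ∀ i, ¬ IntegrableOn (fun ξ => |D.entry i ξ|⁻¹) (Ici 0)) :
    D.system.IsBoundaryControlSystem ∧
    D.system.WellPosed ∧
    D.system.EnergyBalance ∧
    (∀ s : ℂ, 0 < s.re → s ∈ unboundedResolventSet D.system.restrictedOp) ∧
    (∀ (B : D.system.Lifting) (s : ℂ) (hs : s ∈ unboundedResolventSet D.system.restrictedOp)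
      (u : EuclideanSpace ℂ (Fin m)), D.system.transferFunction B s hs u = 0) := by
  have henergy := SignedDiagonal.isEnergyPreserving htravel
  have hA := SignedDiagonal.isMaximalDissipative_restrictedOp htravel
  obtain ⟨B⟩ := D.nonempty_lifting
  exact ⟨henergy.isBoundaryControlSystem hA B, henergy.wellPosed hA B, henergy.energyBalance,
    fun _ => hA.mem_unboundedResolventSet, SignedDiagonal.transferFunction_eq_zero htravel⟩

theorem lemma4p7 {p m : ℕ} (hp : 1 ≤ p) (hm : 1 ≤ m) (D : SignedDiagonal p m)
    (hbdd : ∃ M : ℝ, ∀ i, ∀ ξ : ℝ, 0 ≤ ξ → |D.entry i ξ| ≤ M) :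
    D.system.IsBoundaryControlSystem ∧
    D.system.WellPosed ∧
    D.system.EnergyBalance ∧
    (∀ s : ℂ, 0 < s.re → s ∈ unboundedResolventSet D.system.restrictedOp) ∧
    (∀ (B : D.system.Lifting) (s : ℂ) (hs : s ∈ unboundedResolventSet D.system.restrictedOp)
      (u : EuclideanSpace ℂ (Fin m)), D.system.transferFunction B s hs u = 0) :=
  let ⟨_, hM⟩ := hbdd
  lemma4p7_general D fun i => not_integrableOn_abs_inv (D.entry_ne_zero i) (hM i)
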